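/- An abstract open book is a pair $(\Sigma,\phi)$, where $\Sigma$ is a compact oriented surface with non-empty boundary and $\phi$ is a mapping class of $\Sigma$, i.e. an isotopy class, relative to $\partial\Sigma$, of orientation-preserving homeomorphisms of $\Sigma$ that fix $\partial\Sigma$ pointwise. Let $\alpha$ be a properly embedded arc in $\Sigma$. The positive stabilisation of $(\Sigma,\phi)$ along $\alpha$ is the abstract open book $(\Sigma\cup H_\alpha,\ \phi_\alpha\circ\tau_\alpha)$, where $H_\alpha$ is a one-handle attached to $\Sigma$ along $\partial\alpha\subset\partial\Sigma$ so that $\Sigma\cup H_\alpha$ is oriented compatibly with $\Sigma$, $\phi_\alpha$ is the extension of $\phi$ by the identity on $H_\alpha$, and $\tau_\alpha$ is the positive (right-handed) Dehn twist around the simple closed curve formed by $\alpha$ and the core of $H_\alpha$. The inverse operation, replacing $(\Sigma\cup H_\alpha,\phi_\alpha\circ\tau_\alpha)$ by $(\Sigma,\phi)$, is a positive destabilisation. **Theorem.** Suppose that two abstract open books $(\Sigma_1,\phi_1)$ and $(\Sigma_n,\phi_n)$ are related by a finite sequence of positive stabilisations and destabilisations. Then there is an abstract open book $(\Sigma,\phi)$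 that is a common positive stabilisation of both: it is obtained from $(\Sigma_1,\phi_1)$, and also from $(\Sigma_n,\phi_n)$, by a finite (possibly empty) sequence of positive stabilisations. -/

import Mathlib

open Set Filter Topology

universe u

/-- A point of a surface is an interior point if it has an open neighbourhood homeomorphic to the
plane `ℂ`. -/
def IsInteriorPt {X : Type u} [TopologicalSpace X] (x : X) : Prop :=
  ∃ e : ℂ → X, IsOpenEmbedding e ∧ x ∈ range e

/-- `f` and `g` induce the same local orientation at the point `f z = g w`: read in the
coordinate `g`, the image under `f` of every small circle about `z`, run through
counterclockwise, has winding number `+1` about `w` (that is, `g⁻¹ ∘ f` has local degree `+1`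
at `z`). The function `θ` is a continuous branch of `log (g⁻¹ (f (z + r exp (i t))) - w)`. -/
def SameOrientationAt {X : Type u} (f g : ℂ → X) (z w : ℂ) : Prop :=
  ∀ᶠ r : ℝ in 𝓝[>] 0, ∃ θ : ℝ → ℂ, Continuous θ ∧
    (∀ t, θ (t + 2 * Real.pi) = θ t + 2 * Real.pi * Complex.I) ∧
    ∀ t : ℝ, f (z + r * Complex.exp (t * Complex.I)) = g (w + Complex.exp (θ t))

/-- A compact oriented (topological) surface with possibly empty boundary: a compact Hausdorff
space in which every point has an open neighbourhood homeomorphic to the plane or to the closed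
upper half-plane, together with an oriented atlas of its interior. -/
structure OrientedSurface where
  /-- the underlying space -/
  carrier : Type u
  [topology : TopologicalSpace carrier]
  [compact : CompactSpace carrier]
  [hausdorff : T2Space carrier]
  locally_half_plane : ∀ x : carrier, IsInteriorPt x ∨
    ∃ e : {z : ℂ // 0 ≤ z.im} → carrier, IsOpenEmbedding e ∧ x ∈ range e
  /-- the positively oriented charts of the interior -/
  charts : Set (ℂ → carrier)
  charts_open : ∀ e ∈ charts, IsOpenEmbedding e
  charts_cover : ∀ x : carrier, IsInteriorPt x → ∃ e ∈ charts, x ∈ range e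
  charts_oriented : ∀ e ∈ charts, ∀ e' ∈ charts, ∀ z w : ℂ, e z = e' w →
    SameOrientationAt e e' z w

namespace OrientedSurface

instance : CoeSort OrientedSurface.{u} (Type u) := ⟨carrier⟩

instance (S : OrientedSurface.{u}) : TopologicalSpace S := S.topology

instance (S : OrientedSurface.{u}) : CompactSpace S := S.compact

instance (S : OrientedSurface.{u}) : T2Space S := S.hausdorff

/-- The boundary of a surface. -/
def boundary (S : OrientedSurface.{u}) : Set S := {x | ¬ IsInteriorPt x}

/-- `f` preserves the orientation (of the interiors). -/
def OrientationPreserving (S S' : OrientedSurface.{u}) (f : S → S') : Prop :=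
  ∀ e ∈ S.charts, ∀ e' ∈ S'.charts, ∀ z w : ℂ, f (e z) = e' w →
    SameOrientationAt (f ∘ e) e' z w

/-- The orientation preserving self-homeomorphisms that fix the boundary pointwise. -/
def RelHomeo (S : OrientedSurface.{u}) : Type u :=
  {f : S ≃ₜ S // OrientationPreserving S S f ∧ ∀ x ∈ S.boundary, f x = x}

/-- Isotopy relative to the boundary: a homotopy through homeomorphisms that fix the boundary
pointwise. -/
def Isotopic (S : OrientedSurface.{u}) (f g : S.RelHomeo) : Prop :=
  ContinuousMap.HomotopicWith (f.1 : C(S, S)) (g.1 : C(S, S))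
    fun h => IsHomeomorph h ∧ ∀ x ∈ S.boundary, h x = x

/-- Isotopy relative to the boundary is an equivalence relation. -/
instance isotopySetoid (S : OrientedSurface.{u}) : Setoid S.RelHomeo where
  r := S.Isotopic
  iseqv :=
    { refl := fun f => ContinuousMap.HomotopicWith.refl _ ⟨f.1.isHomeomorph, f.2.2⟩
      symm := fun h => ContinuousMap.HomotopicWith.symm h
      trans := fun h h' => ContinuousMap.HomotopicWith.trans h h' }

/-- Mapping classes of a surface: isotopy classes, relative to the boundary, of orientation
preserving homeomorphisms that fix the boundary pointwise. -/
def MappingClass (S : OrientedSurface.{u}) : Type u := Quotient S.isotopySetoid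

/-- The mapping class of a homeomorphism. -/
def mappingClass (S : OrientedSurface.{u}) (f : S.RelHomeo) : S.MappingClass :=
  Quotient.mk S.isotopySetoid f

/-- A properly embedded arc. -/
structure ProperArc (S : OrientedSurface.{u}) where
  /-- the parametrisation -/
  toFun : unitInterval → S
  continuous_toFun : Continuous toFun
  injective_toFun : Function.Injective toFun
  map_zero : toFun 0 ∈ S.boundary
  map_one : toFun 1 ∈ S.boundary
  map_interior : ∀ t : unitInterval, t ≠ 0 → t ≠ 1 → toFun t ∉ S.boundary

/-- `M` is the oriented surface obtained from `S` by attaching a one-handle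
`[0, 1] × [0, 1]` along `{0, 1} × [0, 1]` to the boundary of `S`. -/
structure OneHandle (S M : OrientedSurface.{u}) where
  /-- the inclusion of the old surface -/
  incl : S → M
  continuous_incl : Continuous incl
  injective_incl : Function.Injective incl
  oriented_incl : OrientationPreserving S M incl
  /-- the inclusion of the handle -/
  handle : unitInterval × unitInterval → M
  continuous_handle : Continuous handle
  injective_handle : Function.Injective handle
  cover : range incl ∪ range handle = univ
  attach_only : ∀ x s t, incl x = handle (s, t) → s = 0 ∨ s = 1
  attach_zero : ∀ t, handle (0, t) ∈ incl '' S.boundary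
  attach_one : ∀ t, handle (1, t) ∈ incl '' S.boundary
  side_zero : ∀ s, handle (s, 0) ∈ M.boundary
  side_one : ∀ s, handle (s, 1) ∈ M.boundary

/-- The core `[0, 1] × {1/2}` of a one-handle. -/
noncomputable def OneHandle.core {S M : OrientedSurface.{u}} (H : OneHandle S M) (s : unitInterval) : M :=
  H.handle (s, ⟨1 / 2, by norm_num, by norm_num⟩)

/-- A positively oriented open annulus, parametrised by the punctured plane `ℂ \ {0}` (the value
of `toFun` at `0` is irrelevant). Its core is the image of the circle `‖z‖ = 3 / 2`. -/
structure Annulus (M : OrientedSurface.{u}) where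
  /-- the parametrisation -/
  toFun : ℂ → M
  isOpenEmbedding : IsOpenEmbedding (fun z : {z : ℂ // z ≠ 0} => toFun z)
  oriented : ∀ e ∈ M.charts, ∀ z w : ℂ, z ≠ 0 → toFun z = e w → SameOrientationAt toFun e z w

/-- The core curve of an annulus. -/
def Annulus.core {M : OrientedSurface.{u}} (A : Annulus M) : Set M :=
  A.toFun '' {z | ‖z‖ = 3 / 2}

/-- The right-handed twist of the plane: it is the identity for `‖z‖ ≤ 1` and for `2 ≤ ‖z‖`, and
turns the circle `‖z‖ = 1 + s`, `0 ≤ s ≤ 1`, clockwise by the angle `2πs`. -/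
noncomputable def planeTwist (z : ℂ) : ℂ :=
  z * Complex.exp (-(2 * Real.pi * (max 0 (min 1 (‖z‖ - 1)) : ℝ) * Complex.I))

/-- `T` is the positive (right-handed) Dehn twist in the annulus `A`. -/
def Annulus.IsPositiveTwist {M : OrientedSurface.{u}} (A : Annulus M) (T : M ≃ₜ M) : Prop :=
  (∀ z : ℂ, z ≠ 0 → T (A.toFun z) = A.toFun (planeTwist z)) ∧
    ∀ x, x ∉ A.toFun '' {0}ᶜ → T x = x

end OrientedSurface

open OrientedSurface

/-- An abstract open book: a compact oriented surface with non-empty boundary (the page) and a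
mapping class of it (the monodromy). -/
structure AbstractOpenBook where
  /-- the page -/
  page : OrientedSurface.{u}
  boundary_nonempty : page.boundary.Nonempty
  /-- the monodromy -/
  monodromy : page.MappingClass

/-- `B'` is the positive stabilisation of `B` along the properly embedded arc `α`: its page is the
page of `B` with a one-handle attached along `∂α`, and its monodromy is the class of
`φ_α ∘ T`, where `φ_α` is the extension by the identity of a representative `φ` of the monodromy
of `B`, and `T` is a positive Dehn twist around the simple closed curve formed by `α` and the
core of the handle. -/
def AbstractOpenBook.IsStabilisationAlong (B B' : AbstractOpenBook.{u}) (α : B.page.ProperArc) :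
    Prop :=
  ∃ H : OneHandle B.page B'.page,
    H.core 0 = H.incl (α.toFun 0) ∧ H.core 1 = H.incl (α.toFun 1) ∧
    ∃ (A : Annulus B'.page) (T φα : B'.page ≃ₜ B'.page) (φ : B.page.RelHomeo)
      (ψ : B'.page.RelHomeo),
      A.core = range (H.incl ∘ α.toFun) ∪ range H.core ∧
      A.IsPositiveTwist T ∧
      B.page.mappingClass φ = B.monodromy ∧
      (∀ x, φα (H.incl x) = H.incl (φ.1 x)) ∧ (∀ p, φα (H.handle p) = H.handle p) ∧
      (∀ x, ψ.1 x = φα (T x)) ∧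
      B'.page.mappingClass ψ = B'.monodromy

/-- `B'` is obtained from `B` by one positive stabilisation (and `B` from `B'` by one positive
destabilisation). -/
def AbstractOpenBook.IsStabilisation (B B' : AbstractOpenBook.{u}) : Prop :=
  ∃ α : B.page.ProperArc, B.IsStabilisationAlong B' α

/-! The proof is a one-step diamond: if $B_1$ and $B_2$ are positive stabilisations of the same $B$,
then some $B_3$ is a positive stabilisation of both (`IsStabilisation.exists_common`). Given the
diamond, having a common iterated stabilisation is an equivalence relation (Church–Rosser), so it
holds along every chain of stabilisations and destabilisations.

For the diamond, let $B_i$ come from the page $\Sigma$ by a handle $H_i$ and a twist $\tau_i$. The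
feet of the two handles may overlap on $\partial\Sigma$. Sliding along the boundary shrinks each
foot into a small neighbourhood of one of its points, and these points can be chosen distinct
(`exists_shrink_attachingRegion`). Such a slide $k$ moves the boundary, but it is isotopic to the
identity, and $k\phi k^{-1}$ is isotopic to $\phi$ relative to the boundary (`isotopicRel_conj`).
Precomposing the inclusion of the page with $k^{-1}$ therefore still presents the same $B_i$ as a
stabilisation of $B$ (`IsStabilisation.exists_data`).

With disjoint feet both handles are attached at once, by gluing the two new pages along $\Sigma$
(`exists_amalgam`). Let $\Phi$ extend $\phi$ by the identity, and take the monodromy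
$\Phi\tau_1\tau_2$. It equals $(\Phi\tau_1)\tau_2$, a stabilisation of $B_1$. It also equals
$(\Phi\tau_2)(\tau_2^{-1}\tau_1\tau_2)$, where the last factor is the positive twist about the
$\tau_2^{-1}$-image of the first curve. Since $\tau_2$ fixes the first handle pointwise, that image
is again an arc of the second page closed up by the core of the first handle. So the result is a
stabilisation of $B_2$ too (`StabilisationData.exists_common`).

As the surfaces are only topological, orientations are handled by winding numbers: the local degree
composes, inverts and is constant along isotopies. -/

/-! ### Continuous logarithms, winding numbers and local orientation -/

/-- Lifting through the covering of the punctured plane by the exponential. -/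
theorem exists_continuous_log {A : Type*} [TopologicalSpace A] [SimplyConnectedSpace A]
    [LocallyPathConnectedSpace A] {φ : A → ℂ} (hφ : Continuous φ) (h0 : ∀ a, φ a ≠ 0) :
    ∃ L : A → ℂ, Continuous L ∧ ∀ a, Complex.exp (L a) = φ a := by
  obtain ⟨a₀⟩ : Nonempty A := inferInstance
  obtain ⟨F, ⟨-, hF⟩, -⟩ := Complex.isCoveringMapOn_exp.existsUnique_continuousMap_lifts
    (⟨φ, hφ⟩ : C(A, ℂ)) (a₀ := a₀) (e₀ := Complex.log (φ a₀)) (Complex.exp_log (h0 a₀))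
    (fun a => h0 a)
  exact ⟨F, F.continuous, fun a => congrFun hF a⟩

theorem exists_eq_add_of_exp_eq {A : Type*} [TopologicalSpace A] [PreconnectedSpace A] [Nonempty A]
    {L L' : A → ℂ} (hL : Continuous L) (hL' : Continuous L')
    (h : ∀ a, Complex.exp (L a) = Complex.exp (L' a)) :
    ∃ n : ℤ, ∀ a, L a = L' a + n * (2 * Real.pi * Complex.I) := by
  obtain ⟨a₀⟩ : Nonempty A := inferInstance
  obtain ⟨n, hn⟩ := Complex.exp_eq_exp_iff_exists_int.1 (h a₀)
  refine ⟨n, fun a => ?_⟩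
  have := Complex.isCoveringMap_exp.eq_of_comp_eq (g₁ := L)
    (g₂ := fun a => L' a + n * (2 * Real.pi * Complex.I)) hL (by fun_prop)
    (by
      funext b
      apply Subtype.ext
      simp only [Function.comp]
      rw [h b]
      exact (Complex.exp_eq_exp_iff_exists_int.2 ⟨-n, by push_cast; ring⟩)) a₀ hn
  exact congrFun this a

theorem Topology.IsOpenEmbedding.continuousOn_invFun {X Y : Type*} [TopologicalSpace X]
    [TopologicalSpace Y] [Nonempty X] {f : X → Y} (hf : IsOpenEmbedding f) :
    ContinuousOn (Function.invFun f) (range f) := by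
  rintro _ ⟨x, rfl⟩
  refine ContinuousAt.continuousWithinAt ?_
  rw [ContinuousAt, ← hf.map_nhds_eq, tendsto_map'_iff, Function.invFun_comp hf.injective,
    Function.leftInverse_invFun hf.injective x]
  exact tendsto_id

/-- The logarithm of the displacement of `f` from `w`, read in the coordinate `h`. -/
theorem exists_log_germ {X : Type*} [TopologicalSpace X] {f h : ℂ → X} {w v : ℂ} {r₀ : ℝ}
    (hr : 0 < r₀) (hh : IsOpenEmbedding h) (hf : ContinuousOn f (Metric.closedBall w r₀))
    (hfr : ∀ u ∈ Metric.closedBall w r₀, f u ∈ range h)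
    (hfi : ∀ u ∈ Metric.closedBall w r₀, f u = h v → u = w) :
    ∃ (Θ : ℂ → ℂ) (n : ℤ), Continuous Θ ∧
      (∀ ζ, Θ (ζ + 2 * Real.pi * Complex.I) = Θ ζ + n * (2 * Real.pi * Complex.I)) ∧
      ∀ ζ : ℂ, ζ.re ≤ Real.log r₀ → f (w + Complex.exp ζ) = h (v + Complex.exp (Θ ζ)) := by
  -- Logarithmic polar coordinates on the punctured disc. Clamping the real part at `log r₀` extends
  -- them to the whole plane, which is simply connected, so that a global logarithm exists.
  set c : ℂ → ℂ := fun ζ => w + Complex.exp (((min ζ.re (Real.log r₀) : ℝ) : ℂ) + ζ.im * Complex.I)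
    with hc
  have hcc : Continuous c := by fun_prop
  have hcm : ∀ ζ, c ζ ∈ Metric.closedBall w r₀ := by
    intro ζ
    simp only [hc, Metric.mem_closedBall, dist_self_add_left, Complex.norm_exp]
    rw [← Real.le_log_iff_exp_le hr]
    simp
  have hcw : ∀ ζ, c ζ ≠ w := by
    intro ζ h
    simp [hc, Complex.exp_ne_zero] at h
  have hinv := hh.continuousOn_invFun
  obtain ⟨Θ, hΘ, hΘe⟩ := exists_continuous_log (A := ℂ) (φ := fun ζ => Function.invFun h (f (c ζ)) - v)
    ((hinv.comp_continuous (hf.comp_continuous hcc hcm) (fun ζ => hfr _ (hcm ζ))).sub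
      continuous_const)
    (fun ζ h0 => hcw ζ (hfi _ (hcm ζ) (by
      rw [← sub_eq_zero.1 h0]; exact (Function.invFun_eq (hfr _ (hcm ζ))).symm)))
  have hper : ∀ ζ, c (ζ + 2 * Real.pi * Complex.I) = c ζ := by
    intro ζ
    simp only [hc]
    congr 1
    refine Complex.exp_eq_exp_iff_exists_int.2 ⟨1, ?_⟩
    simp
    ring
  -- Both sides are logarithms of the same function, since `c` has period `2πi`; the constant `n` is
  -- the winding number.
  obtain ⟨n, hn⟩ := exists_eq_add_of_exp_eq (A := ℂ) (L := fun ζ => Θ (ζ + 2 * Real.pi * Complex.I))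
    (L' := Θ) (by fun_prop) hΘ (fun ζ => by rw [hΘe, hΘe, hper])
  refine ⟨Θ, n, hΘ, hn, fun ζ hζ => ?_⟩
  rw [hΘe, add_sub_cancel, Function.invFun_eq (hfr _ (hcm ζ))]
  simp only [hc, min_eq_left hζ, Complex.re_add_im]

/-- Two logarithms of one loop differ by a constant, so they have the same increment over a period.
-/
theorem winding_unique {θ : ℝ → ℂ} {Θ : ℝ → ℂ} {m n : ℤ} (hθ : Continuous θ)
    (hΘ : Continuous Θ)
    (h1 : ∀ t, θ (t + 2 * Real.pi) = θ t + m * (2 * Real.pi * Complex.I))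
    (h2 : ∀ t, Θ (t + 2 * Real.pi) = Θ t + n * (2 * Real.pi * Complex.I))
    (he : ∀ t, Complex.exp (θ t) = Complex.exp (Θ t)) : m = n := by
  obtain ⟨k, hk⟩ := exists_eq_add_of_exp_eq hθ hΘ he
  have a := hk (0 + 2 * Real.pi)
  rw [h1, h2, hk 0] at a
  have : ((m : ℂ) - n) * (2 * Real.pi * Complex.I) = 0 := by linear_combination a
  rcases mul_eq_zero.1 this with h | h
  · exact_mod_cast sub_eq_zero.1 h
  · exact absurd h Complex.two_pi_I_ne_zero

theorem exp_log_add_mul_I {r : ℝ} (hr : 0 < r) (t : ℝ) :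
    Complex.exp ((Real.log r : ℂ) + t * Complex.I) = r * Complex.exp (t * Complex.I) := by
  rw [Complex.exp_add, ← Complex.ofReal_exp, Real.exp_log hr]

/-- The orientation behaviour is decided by the winding number of any small circle. -/
theorem sameOrientationAt_iff_of_log_germ {X : Type*} [TopologicalSpace X] {f h : ℂ → X} {w v : ℂ}
    {r₀ : ℝ} (hr : 0 < r₀) (hh : Function.Injective h) {Θ : ℂ → ℂ} {n : ℤ} (hΘ : Continuous Θ)
    (hn : ∀ ζ, Θ (ζ + 2 * Real.pi * Complex.I) = Θ ζ + n * (2 * Real.pi * Complex.I))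
    (he : ∀ ζ : ℂ, ζ.re ≤ Real.log r₀ → f (w + Complex.exp ζ) = h (v + Complex.exp (Θ ζ))) :
    SameOrientationAt f h w v ↔ n = 1 := by
  have key : ∀ r ∈ Ioo 0 r₀, ∀ t : ℝ, f (w + r * Complex.exp (t * Complex.I)) =
      h (v + Complex.exp (Θ ((Real.log r : ℂ) + t * Complex.I))) := by
    intro r hr' t
    rw [← exp_log_add_mul_I hr'.1, he]
    simpa using Real.log_le_log hr'.1 hr'.2.le
  have hn' : ∀ r t : ℝ, Θ ((Real.log r : ℂ) + ((t + 2 * Real.pi : ℝ) : ℂ) * Complex.I) =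
      Θ ((Real.log r : ℂ) + t * Complex.I) + n * (2 * Real.pi * Complex.I) := by
    intro r t
    rw [← hn]
    congr 1
    push_cast
    ring
  have hmem : Ioo 0 r₀ ∈ 𝓝[>] (0 : ℝ) := Ioo_mem_nhdsGT hr
  constructor
  · intro hs
    -- A single small circle is enough: on it `θ` and `Θ` are logarithms of the same loop.
    obtain ⟨r, ⟨θ, hθ, hp, hθe⟩, hr'⟩ := (hs.and hmem).exists
    refine (winding_unique (θ := θ) (m := 1) hθ
      (Θ := fun t => Θ ((Real.log r : ℂ) + t * Complex.I)) (by fun_prop)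
      (by simpa using hp) (hn' r) fun t => ?_).symm
    have := hθe t
    rw [key r hr' t] at this
    exact (add_left_cancel (hh this)).symm
  · rintro rfl
    filter_upwards [hmem] with r hr'
    exact ⟨fun t => Θ ((Real.log r : ℂ) + t * Complex.I), by fun_prop,
      by simpa using hn' r, key r hr'⟩

theorem eventually_circle {p : ℂ → Prop} {z : ℂ} (hp : ∀ᶠ u in 𝓝 z, p u) :
    ∀ᶠ r : ℝ in 𝓝[>] 0, ∀ t : ℝ, p (z + r * Complex.exp (t * Complex.I)) := by
  obtain ⟨ε, hε, h⟩ := Metric.eventually_nhds_iff.1 hp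
  filter_upwards [Ioo_mem_nhdsGT hε] with r hr t
  apply h
  simpa [Complex.norm_exp, abs_of_pos hr.1] using hr.2

theorem SameOrientationAt.congr {X : Type*} [TopologicalSpace X] {f f' g : ℂ → X} {z w : ℂ}
    (h : SameOrientationAt f g z w) (hf : f =ᶠ[𝓝 z] f') : SameOrientationAt f' g z w := by
  filter_upwards [h, eventually_circle hf] with r ⟨θ, h1, h2, h3⟩ hr
  exact ⟨θ, h1, h2, fun t => by rw [← hr t, h3]⟩

theorem SameOrientationAt.comp_left {X Y : Type*} [TopologicalSpace X] [TopologicalSpace Y]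
    {f g : ℂ → X} {z w : ℂ} (h : SameOrientationAt f g z w) (j : X → Y) :
    SameOrientationAt (j ∘ f) (j ∘ g) z w := by
  filter_upwards [h] with r ⟨θ, h1, h2, h3⟩
  exact ⟨θ, h1, h2, fun t => congrArg j (h3 t)⟩

theorem exists_closedBall_mem_range {X : Type*} [TopologicalSpace X] {g h : ℂ → X} {w v : ℂ}
    (hg : ContinuousAt g w) (hh : IsOpenEmbedding h) (hgh : g w = h v) :
    ∃ r > 0, ∀ u ∈ Metric.closedBall w r, g u ∈ range h := by
  have := hg (hh.isOpen_range.mem_nhds (hgh ▸ mem_range_self v))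
  obtain ⟨r, hr, h⟩ := Metric.nhds_basis_closedBall.mem_iff.1 this
  exact ⟨r, hr, fun u hu => h hu⟩

/-- Winding numbers multiply under composition: with `θ` a logarithm of `f` read in `g` along a
circle, and `Θ` one of `g` read in `h`, the function `Θ ∘ θ` is a logarithm of `f` read in `h`. -/
theorem SameOrientationAt.trans {X : Type*} [TopologicalSpace X] {f g h : ℂ → X} {z w v : ℂ}
    (h₁ : SameOrientationAt f g z w) (h₂ : SameOrientationAt g h w v) (hf : ContinuousAt f z)
    (hg : IsOpenEmbedding g) (hh : IsOpenEmbedding h) (hfg : f z = g w) (hgh : g w = h v) :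
    SameOrientationAt f h z v := by
  obtain ⟨r₀, hr₀, hr⟩ := exists_closedBall_mem_range hg.continuous.continuousAt hh hgh
  obtain ⟨Θ, n, hΘ, hn, he⟩ := exists_log_germ hr₀ hh hg.continuous.continuousOn hr
    (fun u _ hu => hg.injective (hu.trans hgh.symm))
  obtain rfl := (sameOrientationAt_iff_of_log_germ hr₀ hh.injective hΘ hn he).1 h₂
  -- Small circles about `z` must be carried into the disc on which `Θ` describes `g`.
  have hev : ∀ᶠ u in 𝓝 z, f u ∈ g '' Metric.ball w r₀ :=
    hf ((hg.isOpenMap _ Metric.isOpen_ball).mem_nhds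
      (hfg ▸ mem_image_of_mem g (Metric.mem_ball_self hr₀)))
  filter_upwards [h₁, eventually_circle hev] with r ⟨θ, h1, h2, h3⟩ hr
  refine ⟨fun t => Θ (θ t), by fun_prop, fun t => by simp [h2, hn], fun t => ?_⟩
  rw [h3, he]
  obtain ⟨u, hu, hue⟩ := hr t
  rw [h3] at hue
  rw [hg.injective hue] at hu
  rw [Real.le_log_iff_exp_le hr₀, ← Complex.norm_exp]
  rw [Metric.mem_ball, dist_self_add_left] at hu
  exact hu.le

/-- If `n` is the winding number of `g` read in `f`, composing with `θ` gives a logarithm with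
winding number `n` of the circle itself. The obvious logarithm `log r + it` has winding number `1`,
so `n = 1`. -/
theorem SameOrientationAt.symm {X : Type*} [TopologicalSpace X] {f g : ℂ → X} {z w : ℂ}
    (h : SameOrientationAt f g z w) (hf : IsOpenEmbedding f) (hg : IsOpenEmbedding g)
    (hfg : f z = g w) : SameOrientationAt g f w z := by
  obtain ⟨r₀, hr₀, hr⟩ := exists_closedBall_mem_range hg.continuous.continuousAt hf hfg.symm
  obtain ⟨Θ, n, hΘ, hn, he⟩ := exists_log_germ hr₀ hf hg.continuous.continuousOn hr
    (fun u _ hu => hg.injective (hu.trans hfg))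
  rw [sameOrientationAt_iff_of_log_germ hr₀ hf.injective hΘ hn he]
  have hev : ∀ᶠ u in 𝓝 z, f u ∈ g '' Metric.ball w r₀ :=
    hf.continuous.continuousAt ((hg.isOpenMap _ Metric.isOpen_ball).mem_nhds
      (hfg ▸ mem_image_of_mem g (Metric.mem_ball_self hr₀)))
  obtain ⟨r, ⟨⟨θ, h1, h2, h3⟩, hr⟩, hr'⟩ :=
    ((h.and (eventually_circle hev)).and self_mem_nhdsWithin).exists
  refine winding_unique (θ := fun t => Θ (θ t)) (Θ := fun t => (Real.log r : ℂ) + t * Complex.I)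
    (n := 1) (by fun_prop) (by fun_prop) (fun t => by simp [h2, hn]) (fun t => by push_cast; ring)
    fun t => ?_
  have hre : (θ t).re ≤ Real.log r₀ := by
    obtain ⟨u, hu, hue⟩ := hr t
    rw [h3] at hue
    rw [hg.injective hue] at hu
    rw [Real.le_log_iff_exp_le hr₀, ← Complex.norm_exp]
    rw [Metric.mem_ball, dist_self_add_left] at hu
    exact hu.le
  have := h3 t
  rw [he _ hre] at this
  rw [exp_log_add_mul_I hr']
  exact (add_left_cancel (hf.injective this)).symm

/-- The local degree of a continuous family of local embeddings is locally constant. -/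
theorem eventually_sameOrientationAt_iff {X : Type*} [TopologicalSpace X] {F : ℝ → ℂ → X} {z : ℂ}
    {R : ℝ} (hR : 0 < R) (hF : ContinuousOn (fun p : ℝ × ℂ => F p.1 p.2) (univ ×ˢ Metric.closedBall z R))
    (hi : ∀ τ, InjOn (F τ) (Metric.closedBall z R)) {h : ℂ → X} (hh : IsOpenEmbedding h)
    {τ₀ : ℝ} (h0 : F τ₀ z ∈ range h) :
    ∃ q : Prop, ∀ᶠ τ in 𝓝 τ₀, ∀ v, F τ z = h v → (SameOrientationAt (F τ) h z v ↔ q) := by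
  have hcz : ContinuousAt (fun p : ℝ × ℂ => F p.1 p.2) (τ₀, z) :=
    hF.continuousAt (prod_mem_nhds univ_mem (Metric.closedBall_mem_nhds z hR))
  have := hcz (hh.isOpen_range.mem_nhds h0)
  obtain ⟨ε, hε, hεr⟩ := Metric.nhds_basis_closedBall.mem_iff.1 this
  rw [← closedBall_prod_same] at hεr
  set r := min ε R with hrdef
  have hrpos : 0 < r := lt_min hε hR
  have hrange : ∀ τ ∈ Icc (τ₀ - ε) (τ₀ + ε), ∀ u ∈ Metric.closedBall z r, F τ u ∈ range h := by
    intro τ hτ u hu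
    refine hεr (mk_mem_prod ?_ (Metric.closedBall_subset_closedBall (min_le_left _ _) hu))
    rwa [Real.closedBall_eq_Icc]
  have hsub : Metric.closedBall z r ⊆ Metric.closedBall z R :=
    Metric.closedBall_subset_closedBall (min_le_right _ _)
  -- Clamping the parameter makes the displacement a nowhere-zero function on all of `ℝ × ℝ`, so one
  -- logarithm `L`, hence one integer `n`, serves every `τ` near `τ₀`.
  set cl : ℝ → ℝ := fun τ => max (τ₀ - ε) (min (τ₀ + ε) τ)
  have hcl : ∀ τ, cl τ ∈ Icc (τ₀ - ε) (τ₀ + ε) := fun τ =>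
    ⟨le_max_left _ _, max_le (by linarith) (min_le_left _ _)⟩
  have hclc : Continuous cl := by fun_prop
  set c : ℝ → ℂ := fun t => z + r * Complex.exp (t * Complex.I)
  have hcc : Continuous c := by fun_prop
  have hcm : ∀ t, c t ∈ Metric.closedBall z r := by
    intro t
    simp [c, Complex.norm_exp, abs_of_pos hrpos]
  have hcne : ∀ t, c t ≠ z := by
    intro t h
    simp [c, hrpos.ne', Complex.exp_ne_zero] at h
  have hinv := hh.continuousOn_invFun
  have hc1 : Continuous fun p : ℝ × ℝ => Function.invFun h (F (cl p.1) (c p.2)) :=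
    hinv.comp_continuous (hF.comp_continuous (f := fun p : ℝ × ℝ => (cl p.1, c p.2)) (by fun_prop)
      (fun p => ⟨mem_univ _, hsub (hcm _)⟩)) (fun p => hrange _ (hcl _) _ (hcm _))
  have hzm : z ∈ Metric.closedBall z r := Metric.mem_closedBall_self hrpos.le
  have hc2 : Continuous fun p : ℝ × ℝ => Function.invFun h (F (cl p.1) z) :=
    hinv.comp_continuous (hF.comp_continuous (f := fun p : ℝ × ℝ => (cl p.1, z)) (by fun_prop)
      (fun p => ⟨mem_univ _, hsub hzm⟩)) (fun p => hrange _ (hcl _) _ hzm)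
  obtain ⟨L, hL, hLe⟩ := exists_continuous_log (hc1.sub hc2) (by
    intro p h0
    have := congrArg h (sub_eq_zero.1 h0)
    rw [Function.invFun_eq (hrange _ (hcl _) _ (hcm _)),
      Function.invFun_eq (hrange _ (hcl _) _ hzm)] at this
    exact hcne _ (hi _ (hsub (hcm _)) (hsub hzm) this))
  obtain ⟨n, hn⟩ := exists_eq_add_of_exp_eq (L := fun p : ℝ × ℝ => L (p.1, p.2 + 2 * Real.pi))
    (L' := L) (by fun_prop) hL (fun p => by
      rw [hLe, hLe]
      have : c (p.2 + 2 * Real.pi) = c p.2 := by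
        simp only [c]
        congr 2
        refine Complex.exp_eq_exp_iff_exists_int.2 ⟨1, ?_⟩
        push_cast; ring
      simp only [this, Pi.sub_apply])
  refine ⟨n = 1, ?_⟩
  filter_upwards [Icc_mem_nhds (show τ₀ - ε < τ₀ by linarith) (show τ₀ < τ₀ + ε by linarith)]
    with τ hτ v hv
  have hclτ : cl τ = τ := by simp [cl, hτ.1, hτ.2]
  have hFτ : ContinuousOn (F τ) (Metric.closedBall z r) :=
    hF.comp (f := fun u => (τ, u)) (by fun_prop) (fun u hu => ⟨mem_univ _, hsub hu⟩)
  obtain ⟨Θ, m, hΘ, hm, he⟩ := exists_log_germ hrpos hh hFτ (hrange τ hτ)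
    (fun u hu h' => hi τ (hsub hu) (hsub hzm) (h'.trans hv.symm))
  rw [sameOrientationAt_iff_of_log_germ hrpos hh.injective hΘ hm he]
  have : m = n := by
    refine winding_unique (θ := fun t => Θ ((Real.log r : ℂ) + t * Complex.I))
      (Θ := fun t => L (τ, t)) (by fun_prop) (by fun_prop) (fun t => ?_) (fun t => hn (τ, t))
      fun t => ?_
    · rw [← hm]
      congr 1
      push_cast
      ring
    · have h1 := he ((Real.log r : ℂ) + t * Complex.I) (by simp)
      rw [exp_log_add_mul_I hrpos] at h1
      rw [hLe]
      simp only [hclτ, Pi.sub_apply, c, h1, hv, Function.leftInverse_invFun hh.injective _]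
      ring
  rw [this]

theorem isInteriorPt_of_mem_charts {S : OrientedSurface.{u}} {e : ℂ → S} (he : e ∈ S.charts)
    (z : ℂ) : IsInteriorPt (e z) := ⟨e, S.charts_open e he, mem_range_self z⟩

/-- Read in positive charts of `S`, the map `f` preserves the orientation at `z`. -/
def PositiveAt (S : OrientedSurface.{u}) (f : ℂ → S) (z : ℂ) : Prop :=
  ∀ e ∈ S.charts, ∀ w, f z = e w → SameOrientationAt f e z w

/-- The charts are mutually compatible, so positivity may be tested in a single one. -/
theorem positiveAt_of_chart {S : OrientedSurface.{u}} {f e : ℂ → S} {z w : ℂ}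
    (hf : ContinuousAt f z) (he : e ∈ S.charts) (hfe : f z = e w)
    (h : SameOrientationAt f e z w) : PositiveAt S f z := fun e' he' w' h' =>
  h.trans (S.charts_oriented e he e' he' w w' (hfe.symm.trans h')) hf (S.charts_open e he)
    (S.charts_open e' he') hfe (hfe.symm.trans h')

theorem PositiveAt.congr {S : OrientedSurface.{u}} {f f' : ℂ → S} {z : ℂ} (h : PositiveAt S f z)
    (hf : f =ᶠ[𝓝 z] f') : PositiveAt S f' z := fun e he w hw =>
  (h e he w (hf.eq_of_nhds.trans hw)).congr hf

/-- Positivity is locally constant in the parameter, and the line is connected. -/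
theorem positiveAt_of_isotopy {S : OrientedSurface.{u}} {F : ℝ → ℂ → S} {z : ℂ} {R : ℝ} (hR : 0 < R)
    (hF : ContinuousOn (fun p : ℝ × ℂ => F p.1 p.2) (univ ×ˢ Metric.closedBall z R))
    (hi : ∀ τ, InjOn (F τ) (Metric.closedBall z R)) (hint : ∀ τ, IsInteriorPt (F τ z))
    {a b : ℝ} (ha : PositiveAt S (F a) z) : PositiveAt S (F b) z := by
  have hc : ∀ τ, ContinuousAt (F τ) z := fun τ =>
    (hF.comp (f := fun u => (τ, u)) (by fun_prop) (fun u hu => ⟨mem_univ _, hu⟩)).continuousAt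
      (Metric.closedBall_mem_nhds z hR)
  have hcz : Continuous fun τ => F τ z := hF.comp_continuous (f := fun τ => (τ, z)) (by fun_prop)
      (fun u => ⟨mem_univ _, Metric.mem_closedBall_self hR.le⟩)
  have : IsLocallyConstant fun τ => PositiveAt S (F τ) z := by
    rw [IsLocallyConstant.iff_eventually_eq]
    intro τ₀
    obtain ⟨e, he, hz⟩ := S.charts_cover _ (hint τ₀)
    obtain ⟨q, hq⟩ := eventually_sameOrientationAt_iff hR hF hi (S.charts_open e he) hz
    have hq' : ∀ᶠ τ in 𝓝 τ₀, (PositiveAt S (F τ) z ↔ q) := by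
      filter_upwards [hq, hcz.continuousAt ((S.charts_open e he).isOpen_range.mem_nhds hz)]
        with τ h1 h2
      obtain ⟨v, hv⟩ := h2
      rw [← h1 v hv.symm]
      exact ⟨fun h => h e he v hv.symm, positiveAt_of_chart (hc τ) he hv.symm⟩
    filter_upwards [hq'] with τ h
    rw [eq_iff_iff, h, hq'.self_of_nhds]
  exact (this.apply_eq_of_preconnectedSpace a b) ▸ ha

/-! ### Interior and half-plane points under open embeddings and closed covers -/

theorem isOpenEmbedding_univBall (c : ℂ) (r : ℝ) :
    IsOpenEmbedding (OpenPartialHomeomorph.univBall c r : ℂ → ℂ) :=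
  (OpenPartialHomeomorph.univBall c r).isOpenEmbedding (by simp)

theorem range_univBall (c : ℂ) {r : ℝ} (hr : 0 < r) :
    range (OpenPartialHomeomorph.univBall c r : ℂ → ℂ) = Metric.ball c r := by
  rw [← OpenPartialHomeomorph.univBall_target c hr,
    ← (OpenPartialHomeomorph.univBall c r).image_source_eq_target,
    OpenPartialHomeomorph.univBall_source, image_univ]

/-- The map is a radial rescaling, so about a centre on the real axis it preserves the closed upper
half-plane. -/
theorem exists_pos_im_univBall (c : ℂ) {r : ℝ} (hr : 0 < r) (z : ℂ) :
    ∃ a : ℝ, 0 < a ∧ (OpenPartialHomeomorph.univBall c r z).im = c.im + a * z.im := by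
  have : 0 < 1 + ‖z‖ ^ 2 := by positivity
  refine ⟨r * (√(1 + ‖z‖ ^ 2))⁻¹, by positivity, ?_⟩
  rw [OpenPartialHomeomorph.univBall, dif_pos hr]
  simp [OpenPartialHomeomorph.trans', OpenPartialHomeomorph.univUnitBall,
    OpenPartialHomeomorph.unitBallBall]
  ring

theorem exists_lift_of_isOpenEmbedding {A X Y : Type*} [TopologicalSpace A] [TopologicalSpace X]
    [TopologicalSpace Y] {φ : X → Y} (hφ : IsOpenEmbedding φ) {e : A → Y} (he : IsOpenEmbedding e)
    (h : range e ⊆ range φ) {x : X} (hx : φ x ∈ range e) :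
    ∃ e' : A → X, IsOpenEmbedding e' ∧ x ∈ range e' := by
  choose e' he' using fun a => h (mem_range_self a)
  obtain rfl : φ ∘ e' = e := funext he'
  refine ⟨e', IsOpenEmbedding.of_comp _ hφ he, ?_⟩
  obtain ⟨a, ha⟩ := hx
  exact ⟨a, hφ.injective ha⟩

/-- Being interior is local: a planar chart can be shrunk to a disc inside the image, and an open
disc is again a plane. -/
theorem Topology.IsOpenEmbedding.isInteriorPt_iff {X Y : Type u} [TopologicalSpace X]
    [TopologicalSpace Y] {φ : X → Y} (hφ : IsOpenEmbedding φ) (x : X) :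
    IsInteriorPt (φ x) ↔ IsInteriorPt x := by
  constructor
  · rintro ⟨e, he, z, hz⟩
    obtain ⟨r, hr, h⟩ := Metric.nhds_basis_ball.mem_iff.1
      (he.continuous.continuousAt (x := z) (hφ.isOpen_range.mem_nhds (hz ▸ mem_range_self x)))
    refine exists_lift_of_isOpenEmbedding hφ (he.comp (isOpenEmbedding_univBall z r)) ?_
      ⟨0, by simpa using hz⟩
    rw [range_comp, range_univBall z hr]
    exact image_subset_iff.2 h
  · rintro ⟨e, he, z, rfl⟩
    exact ⟨φ ∘ e, hφ.comp he, z, rfl⟩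

theorem isInteriorPt_complex {U : Set ℂ} (hU : IsOpen U) (z : U) : IsInteriorPt z :=
  (hU.isOpenEmbedding_subtypeVal.isInteriorPt_iff z).1 ⟨id, .id, z, rfl⟩

/-- A point with a neighbourhood homeomorphic to the closed upper half-plane. -/
def HasHalfPlaneNhd {X : Type u} [TopologicalSpace X] (x : X) : Prop :=
  ∃ e : {z : ℂ // 0 ≤ z.im} → X, IsOpenEmbedding e ∧ x ∈ range e

theorem exists_halfPlane_shrink (c : {z : ℂ // 0 ≤ z.im}) (hc : c.1.im = 0) {r : ℝ} (hr : 0 < r) :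
    ∃ δ : {z : ℂ // 0 ≤ z.im} → {z : ℂ // 0 ≤ z.im}, IsOpenEmbedding δ ∧
      c ∈ range δ ∧ range δ ⊆ Metric.ball c r := by
  have him : ∀ z : ℂ, 0 ≤ (OpenPartialHomeomorph.univBall (c : ℂ) r z).im ↔ 0 ≤ z.im := by
    intro z
    obtain ⟨a, ha, h⟩ := exists_pos_im_univBall (c : ℂ) hr z
    rw [h, hc, zero_add, mul_nonneg_iff_of_pos_left ha]
  have hO := isOpenEmbedding_univBall (c : ℂ) r
  have hR := range_univBall (c : ℂ) hr
  set δ : {z : ℂ // 0 ≤ z.im} → {z : ℂ // 0 ≤ z.im} := fun z => ⟨_, (him z).2 z.2⟩ with hδ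
  have hRδ : range δ = Metric.ball c r := by
    ext y
    constructor
    · rintro ⟨z, rfl⟩
      have : (OpenPartialHomeomorph.univBall (c : ℂ) r z) ∈ Metric.ball (c : ℂ) r :=
        hR ▸ mem_range_self _
      exact this
    · intro hy
      have : (y : ℂ) ∈ Metric.ball (c : ℂ) r := hy
      rw [← hR] at this
      obtain ⟨z, hz⟩ := this
      exact ⟨⟨z, (him z).1 (hz ▸ y.2)⟩, Subtype.ext hz⟩
  refine ⟨δ, ⟨?_, hRδ ▸ Metric.isOpen_ball⟩, hRδ ▸ Metric.mem_ball_self hr, hRδ.subset⟩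
  exact IsEmbedding.of_comp ((hO.continuous.comp continuous_subtype_val).subtype_mk _)
    continuous_subtype_val (hO.isEmbedding.comp IsEmbedding.subtypeVal)

theorem isOpenEmbedding_halfPlane_univBall (c : {z : ℂ // 0 ≤ z.im}) (hc : c.1.im ≠ 0) :
    ∃ δ : ℂ → {z : ℂ // 0 ≤ z.im}, IsOpenEmbedding δ ∧ c ∈ range δ := by
  have hpos : 0 < c.1.im := lt_of_le_of_ne c.2 (Ne.symm hc)
  have hO := isOpenEmbedding_univBall (c : ℂ) c.1.im
  have hR := range_univBall (c : ℂ) hpos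
  have him : ∀ z : ℂ, 0 ≤ (OpenPartialHomeomorph.univBall (c : ℂ) c.1.im z).im := by
    intro z
    have : (OpenPartialHomeomorph.univBall (c : ℂ) c.1.im z) ∈ Metric.ball (c : ℂ) c.1.im :=
      hR ▸ mem_range_self _
    rw [Metric.mem_ball, Complex.dist_eq] at this
    have h2 := (Complex.abs_im_le_norm _).trans_lt this
    rw [Complex.sub_im, abs_lt] at h2
    linarith
  refine ⟨fun z => ⟨_, him z⟩, ⟨IsEmbedding.of_comp (hO.continuous.subtype_mk _)
    continuous_subtype_val hO.isEmbedding, ?_⟩, 0, Subtype.ext (by simp)⟩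
  have : range (fun z => (⟨_, him z⟩ : {z : ℂ // 0 ≤ z.im})) =
      Subtype.val ⁻¹' Metric.ball (c : ℂ) c.1.im := by
    rw [← hR]
    ext y
    simp [Subtype.ext_iff]
  rw [this]
  exact Metric.isOpen_ball.preimage continuous_subtype_val

/-- A half-plane chart is shrunk to a half-disc at an edge point and to a full disc elsewhere.
Whether an edge point could also be interior never has to be decided. -/
theorem Topology.IsOpenEmbedding.surfacePt {X Y : Type u} [TopologicalSpace X]
    [TopologicalSpace Y] {φ : X → Y} (hφ : IsOpenEmbedding φ) {x : X}
    (h : IsInteriorPt (φ x) ∨ HasHalfPlaneNhd (φ x)) : IsInteriorPt x ∨ HasHalfPlaneNhd x := by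
  rcases h with h | ⟨e, he, z, hz⟩
  · exact .inl ((hφ.isInteriorPt_iff x).1 h)
  by_cases hz0 : z.1.im = 0
  · right
    obtain ⟨r, hr, h⟩ := Metric.nhds_basis_ball.mem_iff.1
      (he.continuous.continuousAt (x := z) (hφ.isOpen_range.mem_nhds (hz ▸ mem_range_self x)))
    obtain ⟨δ, hδ, ⟨w, hw⟩, hδr⟩ := exists_halfPlane_shrink z hz0 hr
    refine exists_lift_of_isOpenEmbedding hφ (he.comp hδ) ?_ ⟨w, by simp [hw, hz]⟩
    rw [range_comp]
    exact image_subset_iff.2 (hδr.trans h)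
  · left
    obtain ⟨δ, hδ, w, hw⟩ := isOpenEmbedding_halfPlane_univBall z hz0
    exact (hφ.isInteriorPt_iff x).1 ⟨e ∘ δ, he.comp hδ, w, by simp [hw, hz]⟩

theorem Homeomorph.isInteriorPt_iff {X Y : Type u} [TopologicalSpace X] [TopologicalSpace Y]
    (f : X ≃ₜ Y) (x : X) : IsInteriorPt (f x) ↔ IsInteriorPt x :=
  f.isOpenEmbedding.isInteriorPt_iff x

theorem continuous_of_closed_cover {A B Y W : Type*} [TopologicalSpace A] [TopologicalSpace B]
    [TopologicalSpace Y] [TopologicalSpace W] {a : A → Y} {b : B → Y} (ha : IsClosedEmbedding a)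
    (hb : IsClosedEmbedding b) (hab : range a ∪ range b = univ) {g : Y → W}
    (hga : Continuous (g ∘ a)) (hgb : Continuous (g ∘ b)) : Continuous g := by
  rw [continuous_iff_isClosed]
  intro s hs
  have : g ⁻¹' s = a '' ((g ∘ a) ⁻¹' s) ∪ b '' ((g ∘ b) ⁻¹' s) := by
    rw [preimage_comp, preimage_comp, image_preimage_eq_inter_range, image_preimage_eq_inter_range,
      ← inter_union_distrib_left, hab, inter_univ]
  rw [this]
  exact (ha.isClosedMap _ (hs.preimage hga)).union (hb.isClosedMap _ (hs.preimage hgb))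

/-- Off the closed set `K` the image of `f` is everything, so it is the open complement of `K`. This
is how a surface sits in a larger one away from an attached handle. -/
theorem isOpenEmbedding_of_closed_cover {S M : Type*} [TopologicalSpace S] [TopologicalSpace M]
    {f : S → M} (hf : IsEmbedding f) {K : Set M} (hK : IsClosed K) (h : range f ∪ K = univ) :
    IsOpenEmbedding fun x : {x // f x ∉ K} => f x := by
  refine ⟨hf.comp IsEmbedding.subtypeVal, ?_⟩
  convert! hK.isOpen_compl using 1
  ext y
  constructor
  · rintro ⟨x, rfl⟩
    exact x.2
  · intro hy
    rcases (h ▸ mem_univ y : y ∈ range f ∪ K) with ⟨x, rfl⟩ | h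
    · exact ⟨⟨x, hy⟩, rfl⟩
    · exact absurd h hy

theorem isInteriorPt_iff_of_closed_cover {S M : Type u} [TopologicalSpace S] [TopologicalSpace M]
    {f : S → M} (hf : IsEmbedding f) {K : Set M} (hK : IsClosed K) (h : range f ∪ K = univ) {x : S}
    (hx : f x ∉ K) : IsInteriorPt (f x) ↔ IsInteriorPt x :=
  ((isOpenEmbedding_of_closed_cover hf hK h).isInteriorPt_iff ⟨x, hx⟩).trans
    ((hK.isOpen_compl.preimage hf.continuous).isOpenEmbedding_subtypeVal.isInteriorPt_iff
      ⟨x, hx⟩).symm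

theorem surfacePt_of_closed_cover {S M : Type u} [TopologicalSpace S] [TopologicalSpace M]
    {f : S → M} (hf : IsEmbedding f) {K : Set M} (hK : IsClosed K) (h : range f ∪ K = univ) {x : S}
    (hx : f x ∉ K) (hs : IsInteriorPt x ∨ HasHalfPlaneNhd x) :
    IsInteriorPt (f x) ∨ HasHalfPlaneNhd (f x) := by
  have hO := isOpenEmbedding_of_closed_cover hf hK h
  rcases (hK.isOpen_compl.preimage hf.continuous).isOpenEmbedding_subtypeVal.surfacePt
    (x := ⟨x, hx⟩) hs with ⟨e, he, h⟩ | ⟨e, he, z, hz⟩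
  · exact .inl ((hO.isInteriorPt_iff ⟨x, hx⟩).2 ⟨e, he, h⟩)
  · exact .inr ⟨_, hO.comp he, z, by simp [hz]⟩

theorem isOpenEmbedding_comp_of_closed_cover {A S M : Type*} [TopologicalSpace A]
    [TopologicalSpace S] [TopologicalSpace M] {f : S → M} (hf : IsEmbedding f) {K : Set M}
    (hK : IsClosed K) (h : range f ∪ K = univ) {e : A → S} (he : IsOpenEmbedding e)
    (hm : ∀ a, f (e a) ∉ K) : IsOpenEmbedding (f ∘ e) :=
  (isOpenEmbedding_of_closed_cover hf hK h).comp (f := fun a => (⟨e a, hm a⟩ : {x // f x ∉ K}))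
    (IsOpenEmbedding.of_comp (fun a => (⟨e a, hm a⟩ : {x // f x ∉ K}))
      (hK.isOpen_compl.preimage hf.continuous).isOpenEmbedding_subtypeVal he)

/-! ### Orientation preserving maps -/

namespace OrientedSurface

/-- Openness of `g` is required only on interior charts, so that `g` may be the inclusion of a
surface into one with a handle attached, which need not be open at the boundary. -/
theorem OrientationPreserving.comp {S S' S'' : OrientedSurface.{u}} {f : S → S'} {g : S' → S''}
    (hg : OrientationPreserving S' S'' g) (hf : OrientationPreserving S S' f) (hgc : Continuous g)
    (hgo : ∀ e ∈ S'.charts, IsOpenEmbedding (g ∘ e)) (hfc : Continuous f)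
    (hint : ∀ x, IsInteriorPt x → IsInteriorPt (f x)) :
    OrientationPreserving S S'' (g ∘ f) := by
  intro e he e'' he'' z w h
  obtain ⟨e', he', v, hv⟩ := S'.charts_cover _ (hint _ (isInteriorPt_of_mem_charts he z))
  have h1 := (hf e he e' he' z v hv.symm).comp_left g
  have h2 := hg e' he' e'' he'' v w (by rw [hv]; exact h)
  exact h1.trans h2 (hgc.comp (hfc.comp (S.charts_open e he).continuous)).continuousAt
    (hgo e' he') (S''.charts_open e'' he'') (congrArg g hv.symm) (by simp [hv]; exact h)

theorem OrientationPreserving.trans {S : OrientedSurface.{u}} {f g : S ≃ₜ S}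
    (hf : OrientationPreserving S S f) (hg : OrientationPreserving S S g) :
    OrientationPreserving S S (f.trans g) :=
  hg.comp hf g.continuous (fun e he => g.isOpenEmbedding.comp (S.charts_open e he)) f.continuous
    fun x hx => (f.isInteriorPt_iff x).2 hx

theorem orientationPreserving_refl (S : OrientedSurface.{u}) :
    OrientationPreserving S S (Homeomorph.refl S) :=
  fun e he e' he' z w h => S.charts_oriented e he e' he' z w h

theorem OrientationPreserving.symm {S S' : OrientedSurface.{u}} {f : S ≃ₜ S'}
    (hf : OrientationPreserving S S' f) : OrientationPreserving S' S f.symm := by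
  intro e he e' he' z w h
  have h' : f (e' w) = e z := by rw [← h]; simp
  have := ((hf e' he' e he w z h').symm (f.isOpenEmbedding.comp (S.charts_open e' he'))
    (S'.charts_open e he) h').comp_left f.symm
  simpa [Function.comp_def] using this

theorem orientationPreserving_of_isotopy {S : OrientedSurface.{u}} (F : unitInterval → S ≃ₜ S)
    (hF : Continuous fun p : unitInterval × S => F p.1 p.2)
    {a b : unitInterval} (ha : OrientationPreserving S S (F a)) :
    OrientationPreserving S S (F b) := by
  intro e he e' he' z w h
  have hec := (S.charts_open e he).continuous
  have := positiveAt_of_isotopy (S := S) (z := z) (R := 1)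
    (F := fun τ u => F (projIcc 0 1 zero_le_one τ) (e u)) one_pos
    (Continuous.continuousOn (hF.comp (f := fun p : ℝ × ℂ => (projIcc 0 1 zero_le_one p.1, e p.2))
      (by fun_prop)))
    (fun τ => ((F _).injective.comp (S.charts_open e he).injective).injOn)
    (fun τ => ((F _).isInteriorPt_iff _).2 (isInteriorPt_of_mem_charts he z))
    (a := a) (b := b) (fun e' he' w hw => by
      simp only [projIcc_val] at hw ⊢
      exact ha e he e' he' z w hw)
  have h2 := this e' he' w (by simpa using h)
  simpa [Function.comp_def] using h2

theorem _root_.Homeomorph.mem_boundary_iff {S : OrientedSurface.{u}} (f : S ≃ₜ S) (x : S) :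
    f x ∈ S.boundary ↔ x ∈ S.boundary := not_congr (f.isInteriorPt_iff x)

/-! ### Dehn twists in annuli -/

namespace Annulus

variable {M : OrientedSurface.{u}} (A : Annulus M)

theorem continuousOn : ContinuousOn A.toFun {0}ᶜ :=
  continuousOn_iff_continuous_domRestrict.2 A.isOpenEmbedding.continuous

theorem isInteriorPt {z : ℂ} (hz : z ≠ 0) : IsInteriorPt (A.toFun z) := by
  obtain ⟨e, he, w, hw⟩ := isInteriorPt_complex (U := {z : ℂ | z ≠ 0}) isOpen_ne ⟨z, hz⟩
  exact ⟨_, A.isOpenEmbedding.comp he, w, congrArg (fun z : {z : ℂ // z ≠ 0} => A.toFun z) hw⟩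

/-- The rotation of the circles of the plane that interpolates between the identity and
`planeTwist`. -/
noncomputable def partialTwist (τ : ℝ) (z : ℂ) : ℂ :=
  z * Complex.exp (-(2 * Real.pi * (τ * (max 0 (min 1 (‖z‖ - 1)) : ℝ) : ℝ) * Complex.I))

theorem continuous_partialTwist : Continuous fun p : ℝ × ℂ => partialTwist p.1 p.2 := by
  unfold partialTwist
  fun_prop

theorem norm_partialTwist (τ : ℝ) (z : ℂ) : ‖partialTwist τ z‖ = ‖z‖ := by
  rw [partialTwist, norm_mul, ← Complex.ofReal_ofNat, ← Complex.ofReal_mul, ← Complex.ofReal_mul,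
    ← neg_mul, ← Complex.ofReal_neg, Complex.norm_exp_ofReal_mul_I, mul_one]

/-- The norm is preserved, and the angle of rotation depends only on the norm. -/
theorem partialTwist_injective (τ : ℝ) : Function.Injective (partialTwist τ) := by
  intro z w h
  have hn := congrArg norm h
  rw [norm_partialTwist, norm_partialTwist] at hn
  rw [partialTwist, partialTwist, hn] at h
  exact mul_right_cancel₀ (Complex.exp_ne_zero _) h

theorem partialTwist_ne_zero (τ : ℝ) {z : ℂ} (hz : z ≠ 0) : partialTwist τ z ≠ 0 := by
  rw [← norm_ne_zero_iff, norm_partialTwist]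
  exact norm_ne_zero_iff.2 hz

theorem partialTwist_zero (z : ℂ) : partialTwist 0 z = z := by simp [partialTwist]

theorem partialTwist_one (z : ℂ) : partialTwist 1 z = planeTwist z := by
  simp [partialTwist, planeTwist]

theorem planeTwist_eq_self {z : ℂ} (hz : ¬ (1 ≤ ‖z‖ ∧ ‖z‖ ≤ 2)) : planeTwist z = z := by
  rw [planeTwist]
  by_cases h : 1 ≤ ‖z‖
  · have h2 : 2 < ‖z‖ := by
      by_contra h'
      exact hz ⟨h, not_lt.1 h'⟩
    rw [min_eq_left (by linarith), max_eq_right zero_le_one]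
    have : Complex.exp (-(2 * Real.pi * ((1 : ℝ) : ℂ) * Complex.I)) = 1 := by
      rw [Complex.exp_eq_one_iff]
      exact ⟨-1, by push_cast; ring⟩
    rw [this, mul_one]
  · rw [max_eq_left ((min_le_right _ _).trans (by linarith))]
    simp

/-- Near a point of the annulus, `partialTwist` deforms the identity to the twist. For `0 < τ < 1`
it does not extend by the identity past the outer circle, so the isotopy is used only locally. Near
any other point the twist is the identity. -/
theorem IsPositiveTwist.orientationPreserving {A : Annulus M} {T : M ≃ₜ M} (hT : A.IsPositiveTwist T) :
    OrientationPreserving M M T := by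
  suffices h : ∀ e ∈ M.charts, ∀ z, PositiveAt M (T ∘ e) z from
    fun e he e' he' z w hw => h e he z e' he' w hw
  intro e he z
  have hec := M.charts_open e he
  have hpos : PositiveAt M e z := fun e' he' w hw => M.charts_oriented e he e' he' z w hw
  have : Nonempty {z : ℂ // z ≠ 0} := ⟨⟨1, one_ne_zero⟩⟩
  set A₀ : {z : ℂ // z ≠ 0} → M := fun z => A.toFun z with hA₀
  have hO : IsOpenEmbedding A₀ := A.isOpenEmbedding
  by_cases hz : e z ∈ range A₀
  · obtain ⟨R, hR, hsub⟩ := Metric.nhds_basis_closedBall.mem_iff.1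
      (hec.continuous.continuousAt (x := z) (hO.isOpen_range.mem_nhds hz))
    set F : ℝ → ℂ → M := fun τ u =>
      A₀ ⟨partialTwist τ (Function.invFun A₀ (e u)).1,
        partialTwist_ne_zero τ (Function.invFun A₀ (e u)).2⟩
      with hF
    have hinv : ContinuousOn (fun u => Function.invFun A₀ (e u)) (Metric.closedBall z R) :=
      hO.continuousOn_invFun.comp hec.continuous.continuousOn hsub
    have hA : ∀ u ∈ Metric.closedBall z R, A₀ (Function.invFun A₀ (e u)) = e u :=
      fun u hu => Function.invFun_eq (hsub hu)
    have hFc : ContinuousOn (fun p : ℝ × ℂ => F p.1 p.2) (univ ×ˢ Metric.closedBall z R) := by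
      refine hO.continuous.comp_continuousOn ?_
      refine IsInducing.subtypeVal.continuousOn_iff.2 ?_
      exact continuous_partialTwist.comp_continuousOn (f := fun p : ℝ × ℂ =>
        (p.1, (Function.invFun A₀ (e p.2)).1)) (continuousOn_fst.prodMk
          (continuous_subtype_val.comp_continuousOn (hinv.comp continuousOn_snd fun p hp => hp.2)))
    have hinj : ∀ τ, InjOn (F τ) (Metric.closedBall z R) := by
      intro τ u hu v hv h
      have h1 := partialTwist_injective τ (congrArg Subtype.val (hO.injective h))
      have h2 := congrArg A₀ (Subtype.ext h1)
      rw [hA u hu, hA v hv] at h2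
      exact hec.injective h2
    have h0 : F 0 =ᶠ[𝓝 z] e := by
      filter_upwards [Metric.closedBall_mem_nhds z hR] with u hu
      simp only [hF, partialTwist_zero]
      exact hA u hu
    have h1 : F 1 =ᶠ[𝓝 z] T ∘ e := by
      filter_upwards [Metric.closedBall_mem_nhds z hR] with u hu
      simp only [hF, partialTwist_one, Function.comp]
      exact (hT.1 _ (Function.invFun A₀ (e u)).2).symm.trans (congrArg T (hA u hu))
    exact (positiveAt_of_isotopy hR hFc hinj (fun τ => A.isInteriorPt (partialTwist_ne_zero _
      (Function.invFun A₀ (e z)).2)) (a := 0) (b := 1) (hpos.congr h0.symm)).congr h1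
  -- The twist is supported in the compact, hence closed, annulus `1 ≤ ‖z‖ ≤ 2`, so a point outside
  -- the open annulus has a neighbourhood that is fixed.
  · have hK : IsCompact (A.toFun '' {z | 1 ≤ ‖z‖ ∧ ‖z‖ ≤ 2}) := by
      refine IsCompact.image_of_continuousOn ?_ (A.continuousOn.mono ?_)
      · refine (isCompact_closedBall (0 : ℂ) 2).of_isClosed_subset ?_ (fun z hz => by simpa using hz.2)
        exact (isClosed_le continuous_const continuous_norm).inter
          (isClosed_le continuous_norm continuous_const)
      · rintro z ⟨hz, -⟩ rfl
        norm_num at hz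
    refine hpos.congr ?_
    have hzK : e z ∉ A.toFun '' {z | 1 ≤ ‖z‖ ∧ ‖z‖ ≤ 2} := by
      rintro ⟨a, ha, hae⟩
      refine hz ⟨⟨a, ?_⟩, hae⟩
      rintro rfl
      norm_num at ha
    filter_upwards [hec.continuous.continuousAt (x := z) (hK.isClosed.isOpen_compl.mem_nhds hzK)] with u hu
    by_cases hu' : e u ∈ A.toFun '' {0}ᶜ
    · obtain ⟨a, ha, hae⟩ := hu'
      simp only [Function.comp, ← hae]
      rw [hT.1 a ha, planeTwist_eq_self]
      exact fun h => hu ⟨a, h, hae⟩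
    · exact (hT.2 _ hu').symm

theorem IsPositiveTwist.apply_of_mem_boundary {A : Annulus M} {T : M ≃ₜ M}
    (hT : A.IsPositiveTwist T) : ∀ x ∈ M.boundary, T x = x := by
  intro x hx
  refine hT.2 x ?_
  rintro ⟨z, hz, rfl⟩
  exact hx (A.isInteriorPt hz)

/-- The image of an annulus under an orientation preserving homeomorphism. -/
def mapHomeo (k : M ≃ₜ M) (hk : OrientationPreserving M M k) : Annulus M where
  toFun := k ∘ A.toFun
  isOpenEmbedding := k.isOpenEmbedding.comp A.isOpenEmbedding
  oriented := by
    intro e he z w hz h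
    obtain ⟨e', he', v, hv⟩ := M.charts_cover _ (A.isInteriorPt hz)
    exact ((A.oriented e' he' z v hz hv.symm).comp_left k).trans
      (hk e' he' e he v w (by rw [hv]; exact h))
      ((k.continuous.comp_continuousOn A.continuousOn).continuousAt (isOpen_ne.mem_nhds hz))
      (k.isOpenEmbedding.comp (M.charts_open e' he')) (M.charts_open e he)
      (congrArg k hv.symm) (by rw [← h]; exact congrArg k hv)

theorem core_mapHomeo (k : M ≃ₜ M) (hk : OrientationPreserving M M k) :
    (A.mapHomeo k hk).core = k '' A.core := by
  simp [core, mapHomeo, image_image, Function.comp_def]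

/-- Conjugating a twist by `k` twists about the image curve. This is what allows the order of two
stabilisations to be exchanged. -/
theorem IsPositiveTwist.mapHomeo {A : Annulus M} {T : M ≃ₜ M} (hT : A.IsPositiveTwist T)
    (k : M ≃ₜ M) (hk : OrientationPreserving M M k) :
    (A.mapHomeo k hk).IsPositiveTwist ((k.symm.trans T).trans k) := by
  refine ⟨fun z hz => by simp [Annulus.mapHomeo, hT.1 z hz], fun x hx => ?_⟩
  simp only [Homeomorph.trans_apply]
  rw [hT.2, Homeomorph.apply_symm_apply]
  rintro ⟨z, hz, h⟩
  exact hx ⟨z, hz, by simp [Annulus.mapHomeo, h]⟩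

end Annulus

/-! ### Extension over a one-handle by the identity -/

namespace OneHandle

variable {S M : OrientedSurface.{u}} (H : OneHandle S M)

theorem isClosedEmbedding_incl : IsClosedEmbedding H.incl :=
  H.continuous_incl.isClosedEmbedding H.injective_incl

theorem isClosedEmbedding_handle : IsClosedEmbedding H.handle :=
  H.continuous_handle.isClosedEmbedding H.injective_handle

/-- The attaching region in the old surface. -/
def attachingRegion : Set S := H.incl ⁻¹' range H.handle

theorem mem_boundary_of_mem_attachingRegion {x : S} (hx : x ∈ H.attachingRegion) :
    x ∈ S.boundary := by
  obtain ⟨⟨s, t⟩, h⟩ := hx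
  rcases H.attach_only x s t h.symm with rfl | rfl
  · obtain ⟨y, hy, h'⟩ := H.attach_zero t
    rwa [← H.injective_incl (h'.trans h)]
  · obtain ⟨y, hy, h'⟩ := H.attach_one t
    rwa [← H.injective_incl (h'.trans h)]

theorem isInteriorPt_incl_iff {x : S} (hx : x ∉ H.attachingRegion) :
    IsInteriorPt (H.incl x) ↔ IsInteriorPt x :=
  isInteriorPt_iff_of_closed_cover H.isClosedEmbedding_incl.isEmbedding
    H.isClosedEmbedding_handle.isClosed_range H.cover hx

theorem isInteriorPt_incl {x : S} (hx : IsInteriorPt x) : IsInteriorPt (H.incl x) :=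
  (H.isInteriorPt_incl_iff fun h => H.mem_boundary_of_mem_attachingRegion h hx).2 hx

theorem isOpenEmbedding_incl_comp {A : Type*} [TopologicalSpace A] {e : A → S}
    (he : IsOpenEmbedding e) (hint : ∀ a, IsInteriorPt (e a)) : IsOpenEmbedding (H.incl ∘ e) :=
  isOpenEmbedding_comp_of_closed_cover H.isClosedEmbedding_incl.isEmbedding
    H.isClosedEmbedding_handle.isClosed_range H.cover he
    fun a h => H.mem_boundary_of_mem_attachingRegion h (hint a)

theorem exists_eq (y : M) : (∃ x, H.incl x = y) ∨ ∃ p, H.handle p = y := by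
  have : y ∈ range H.incl ∪ range H.handle := H.cover ▸ mem_univ y
  exact this

open Classical in
/-- The extension of a map of the old surface by the identity on the handle. -/
noncomputable def extFun (f : S → S) (y : M) : M :=
  if h : ∃ x, H.incl x = y then H.incl (f h.choose) else y

theorem extFun_incl (f : S → S) (x : S) : H.extFun f (H.incl x) = H.incl (f x) := by
  have h : ∃ x', H.incl x' = H.incl x := ⟨x, rfl⟩
  rw [extFun, dif_pos h, H.injective_incl h.choose_spec]

theorem extFun_handle {f : S → S} (hf : ∀ x ∈ S.boundary, f x = x) (p : unitInterval × unitInterval) :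
    H.extFun f (H.handle p) = H.handle p := by
  by_cases h : ∃ x, H.incl x = H.handle p
  · obtain ⟨x, hx⟩ := h
    rw [← hx, H.extFun_incl, hf x (H.mem_boundary_of_mem_attachingRegion ⟨p, hx.symm⟩)]
  · rw [extFun, dif_neg h]

/-- The family version covers both single homeomorphisms (`T := Unit`) and isotopies. -/
theorem continuous_extFun {T : Type*} [TopologicalSpace T] {F : T → S → S}
    (hF : Continuous fun p : T × S => F p.1 p.2) (hb : ∀ t, ∀ x ∈ S.boundary, F t x = x) :
    Continuous fun p : T × M => H.extFun (F p.1) p.2 := by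
  refine continuous_of_closed_cover (IsClosedEmbedding.id.prodMap H.isClosedEmbedding_incl)
    (IsClosedEmbedding.id.prodMap H.isClosedEmbedding_handle) ?_ ?_ ?_
  · rw [range_prodMap, range_prodMap, ← prod_union, H.cover, range_id, univ_prod_univ]
  · simp only [Function.comp_def, Prod.map, id, extFun_incl]
    exact H.continuous_incl.comp hF
  · simp only [Function.comp_def, Prod.map, id, H.extFun_handle (hb _)]
    exact H.continuous_handle.comp continuous_snd

theorem extFun_extFun {f g : S → S} (hf : ∀ x ∈ S.boundary, f x = x)
    (hg : ∀ x ∈ S.boundary, g x = x) (y : M) : H.extFun f (H.extFun g y) = H.extFun (f ∘ g) y := by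
  rcases H.exists_eq y with ⟨x, rfl⟩ | ⟨p, rfl⟩
  · simp only [extFun_incl, Function.comp]
  · rw [H.extFun_handle hg, H.extFun_handle hf, H.extFun_handle]
    intro x hx
    rw [Function.comp, hg x hx, hf x hx]

theorem extFun_eq_self {f : S → S} (hf : ∀ x, f x = x) (y : M) : H.extFun f y = y := by
  rcases H.exists_eq y with ⟨x, rfl⟩ | ⟨p, rfl⟩
  · rw [extFun_incl, hf]
  · rw [H.extFun_handle fun x _ => hf x]

theorem symm_apply_of_mem_boundary {f : S ≃ₜ S} (hf : ∀ x ∈ S.boundary, f x = x) :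
    ∀ x ∈ S.boundary, f.symm x = x := fun x hx => by
  rw [Homeomorph.symm_apply_eq, hf x hx]

/-- The extension of a homeomorphism of the old surface by the identity on the handle. -/
noncomputable def ext (f : S ≃ₜ S) (hf : ∀ x ∈ S.boundary, f x = x) : M ≃ₜ M where
  toFun := H.extFun f
  invFun := H.extFun f.symm
  left_inv y := by
    rw [H.extFun_extFun (symm_apply_of_mem_boundary hf) hf, H.extFun_eq_self (by simp)]
  right_inv y := by
    rw [H.extFun_extFun hf (symm_apply_of_mem_boundary hf), H.extFun_eq_self (by simp)]
  continuous_toFun := (H.continuous_extFun (T := Unit) (F := fun _ => f)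
    (f.continuous.comp continuous_snd) (fun _ => hf)).comp (by fun_prop : Continuous fun y : M => ((), y))
  continuous_invFun := (H.continuous_extFun (T := Unit) (F := fun _ => f.symm)
    (f.symm.continuous.comp continuous_snd) (fun _ => symm_apply_of_mem_boundary hf)).comp
    (by fun_prop : Continuous fun y : M => ((), y))

theorem ext_incl (f : S ≃ₜ S) (hf : ∀ x ∈ S.boundary, f x = x) (x : S) :
    H.ext f hf (H.incl x) = H.incl (f x) := H.extFun_incl f x

theorem ext_handle (f : S ≃ₜ S) (hf : ∀ x ∈ S.boundary, f x = x) (p : unitInterval × unitInterval) :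
    H.ext f hf (H.handle p) = H.handle p := H.extFun_handle hf p

theorem ext_apply_of_mem_boundary (f : S ≃ₜ S) (hf : ∀ x ∈ S.boundary, f x = x) :
    ∀ y ∈ M.boundary, H.ext f hf y = y := by
  intro y hy
  rcases H.exists_eq y with ⟨x, rfl⟩ | ⟨p, rfl⟩
  · rw [H.ext_incl, hf x fun h => hy (H.isInteriorPt_incl h)]
  · exact H.ext_handle f hf p

theorem eq_ext {f : S ≃ₜ S} (hf : ∀ x ∈ S.boundary, f x = x) {g : M → M}
    (h1 : ∀ x, g (H.incl x) = H.incl (f x)) (h2 : ∀ p, g (H.handle p) = H.handle p) (y : M) :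
    g y = H.ext f hf y := by
  rcases H.exists_eq y with ⟨x, rfl⟩ | ⟨p, rfl⟩
  · rw [h1, H.ext_incl]
  · rw [h2, H.ext_handle]

/-- An annulus of the old surface, seen in the new one. -/
def mapAnnulus (A : Annulus S) : Annulus M where
  toFun := H.incl ∘ A.toFun
  isOpenEmbedding := H.isOpenEmbedding_incl_comp A.isOpenEmbedding fun z => A.isInteriorPt z.2
  oriented := by
    intro e he z w hz h
    obtain ⟨e', he', v, hv⟩ := S.charts_cover _ (A.isInteriorPt hz)
    exact ((A.oriented e' he' z v hz hv.symm).comp_left H.incl).trans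
      (H.oriented_incl e' he' e he v w (by rw [hv]; exact h))
      ((H.continuous_incl.comp_continuousOn A.continuousOn).continuousAt (isOpen_ne.mem_nhds hz))
      (H.isOpenEmbedding_incl_comp (S.charts_open e' he') (isInteriorPt_of_mem_charts he'))
      (M.charts_open e he) (congrArg H.incl hv.symm) (by rw [← h]; exact congrArg H.incl hv)

theorem core_mapAnnulus (A : Annulus S) : (H.mapAnnulus A).core = H.incl '' A.core := by
  simp [Annulus.core, mapAnnulus, image_image, Function.comp_def]

theorem isPositiveTwist_ext {A : Annulus S} {T : S ≃ₜ S} (hT : A.IsPositiveTwist T) :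
    (H.mapAnnulus A).IsPositiveTwist (H.ext T hT.apply_of_mem_boundary) := by
  refine ⟨fun z hz => ?_, fun y hy => ?_⟩
  · simp only [mapAnnulus, Function.comp]
    rw [H.ext_incl, hT.1 z hz]
  · rcases H.exists_eq y with ⟨x, rfl⟩ | ⟨p, rfl⟩
    · rw [H.ext_incl, hT.2]
      rintro ⟨z, hz, rfl⟩
      exact hy ⟨z, hz, rfl⟩
    · exact H.ext_handle _ _ p

end OneHandle

end OrientedSurface

/-! ### Ambient isotopies and pushes along the edge of the half-plane -/

/-- `k` is isotopic to the identity by an isotopy supported in `N`. -/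
def IsIsotopicToId {X : Type*} [TopologicalSpace X] (N : Set X) (k : X ≃ₜ X) : Prop :=
  ∃ F : unitInterval → X ≃ₜ X, (Continuous fun p : unitInterval × X => F p.1 p.2) ∧
    F 0 = Homeomorph.refl X ∧ F 1 = k ∧ ∀ t, ∀ x ∉ N, F t x = x

namespace IsIsotopicToId

variable {X : Type*} [TopologicalSpace X] {N N' : Set X} {k k' : X ≃ₜ X}

theorem refl (N : Set X) : IsIsotopicToId N (Homeomorph.refl X) :=
  ⟨fun _ => Homeomorph.refl X, continuous_snd, rfl, rfl, fun _ _ _ => rfl⟩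

theorem mono (h : IsIsotopicToId N k) (hN : N ⊆ N') : IsIsotopicToId N' k := by
  obtain ⟨F, h1, h2, h3, h4⟩ := h
  exact ⟨F, h1, h2, h3, fun t x hx => h4 t x fun h => hx (hN h)⟩

theorem trans (h : IsIsotopicToId N k) (h' : IsIsotopicToId N k') :
    IsIsotopicToId N (k.trans k') := by
  obtain ⟨F, h1, h2, h3, h4⟩ := h
  obtain ⟨F', h1', h2', h3', h4'⟩ := h'
  refine ⟨fun t => (F t).trans (F' t), ?_, ?_, ?_, fun t x hx => ?_⟩
  · exact h1'.comp (continuous_fst.prodMk h1)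
  · simp only [h2, h2']
    rfl
  · simp only [h3, h3']
  · rw [Homeomorph.trans_apply, h4 t x hx, h4' t x hx]

theorem apply_of_notMem (h : IsIsotopicToId N k) {x : X} (hx : x ∉ N) : k x = x := by
  obtain ⟨F, -, -, rfl, h4⟩ := h
  exact h4 1 x hx

end IsIsotopicToId

/-- The horizontal displacement of a push in the ball of radius `η` about `c`. -/
noncomputable def pushShift (c : ℂ) (η τ : ℝ) (z : ℂ) : ℝ := τ * (max 0 (η - dist z c) / 2)

/-- The tent `max 0 (η - dist z c)` is 1-Lipschitz. The factor `1 / 2` in `pushShift` makes the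
displacement a strict contraction, which gives bijectivity of the push. -/
theorem dist_pushShift_le {c : ℂ} {η τ : ℝ} (hτ : |τ| ≤ 1) (z w : ℂ) :
    |pushShift c η τ z - pushShift c η τ w| ≤ 1 / 2 * dist z w := by
  have h1 : |max 0 (η - dist z c) - max 0 (η - dist w c)| ≤ dist z w := by
    rw [max_comm 0, max_comm 0]
    refine (abs_max_sub_max_le_abs _ _ _).trans ?_
    rw [sub_sub_sub_cancel_left, abs_sub_comm]
    exact abs_dist_sub_le z w c
  rw [pushShift, pushShift, ← mul_sub, abs_mul, ← sub_div, abs_div, abs_two]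
  calc |τ| * (_ / 2) ≤ 1 * (dist z w / 2) := by gcongr
    _ = _ := by ring

theorem pushShift_eq_zero {c : ℂ} {η : ℝ} (τ : ℝ) {z : ℂ} (hz : z ∉ Metric.ball c η) :
    pushShift c η τ z = 0 := by
  rw [Metric.mem_ball, not_lt] at hz
  rw [pushShift, max_eq_left (by linarith)]
  simp

theorem continuous_pushShift (c : ℂ) (η : ℝ) :
    Continuous fun p : ℝ × ℂ => pushShift c η p.1 p.2 := by
  unfold pushShift
  fun_prop

/-- The push of the half-plane. -/
noncomputable def halfPlanePush (c : ℂ) (η τ : ℝ) (z : {z : ℂ // 0 ≤ z.im}) : {z : ℂ // 0 ≤ z.im} :=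
  ⟨z - pushShift c η τ z, by simpa using z.2⟩

theorem halfPlanePush_bijective (c : ℂ) (η : ℝ) {τ : ℝ} (hτ : |τ| ≤ 1) :
    Function.Bijective (halfPlanePush c η τ) := by
  have hd : ∀ z w : ℂ, dist (pushShift c η τ z : ℂ) (pushShift c η τ w : ℂ) ≤ 1 / 2 * dist z w := by
    intro z w
    rw [Complex.dist_eq, ← Complex.ofReal_sub, Complex.norm_real]
    exact dist_pushShift_le hτ z w
  constructor
  · intro z w h
    have h' : (z : ℂ) - pushShift c η τ z = w - pushShift c η τ w := congrArg Subtype.val h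
    have h2 : dist (z : ℂ) w = dist (pushShift c η τ z : ℂ) (pushShift c η τ w : ℂ) := by
      rw [Complex.dist_eq, Complex.dist_eq]
      congr 1
      linear_combination h'
    have h3 := hd z w
    rw [← h2] at h3
    have h4 : dist (z : ℂ) w ≤ 0 := by linarith
    exact Subtype.ext (dist_le_zero.1 h4)
  · intro y
    -- The preimage of `y` is the fixed point of `z ↦ y + shift z`; the shift is real, so it stays
    -- in the half-plane.
    have hc : ContractingWith (1 / 2) fun z : ℂ => (y : ℂ) + pushShift c η τ z := by
      refine ⟨by
        rw [← NNReal.coe_lt_coe]; norm_num, LipschitzWith.of_dist_le_mul fun z w => ?_⟩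
      simpa using hd z w
    have hfix := hc.fixedPoint_isFixedPt
    set z := hc.fixedPoint
    have hz : (y : ℂ) + pushShift c η τ z = z := hfix
    refine ⟨⟨z, ?_⟩, Subtype.ext ?_⟩
    · rw [← hz]
      simpa using y.2
    · change z - pushShift c η τ z = y
      linear_combination -hz

theorem halfPlanePush_of_notMem {c : ℂ} {η : ℝ} (τ : ℝ) {z : {z : ℂ // 0 ≤ z.im}}
    (hz : (z : ℂ) ∉ Metric.ball c η) : halfPlanePush c η τ z = z :=
  Subtype.ext (by simp [halfPlanePush, pushShift_eq_zero τ hz])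

theorem extend_push_of_notMem {X : Type*} {e : {z : ℂ // 0 ≤ z.im} → X}
    (he : Function.Injective e) {c : ℂ} {η : ℝ} (τ : ℝ) {y : X}
    (hy : y ∉ e '' {z | (z : ℂ) ∈ Metric.ball c η}) :
    Function.extend e (e ∘ halfPlanePush c η τ) id y = y := by
  by_cases h : ∃ z, e z = y
  · obtain ⟨z, rfl⟩ := h
    rw [he.extend_apply, Function.comp, halfPlanePush_of_notMem]
    exact fun h => hy ⟨z, h, rfl⟩
  · rw [Function.extend_apply' _ _ _ h, id]

/-- The space is covered by two closed sets: the compact image of the closed half-ball, and the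
complement of the image of the open one, where the push is the identity. -/
theorem continuous_extend_push {X : Type*} [TopologicalSpace X] [T2Space X]
    {e : {z : ℂ // 0 ≤ z.im} → X} (he : IsOpenEmbedding e) (c : ℂ) (η : ℝ) : Continuous fun p : ℝ × X =>
    Function.extend e (e ∘ halfPlanePush c η p.1) id p.2 := by
  have hcl : IsClosed {z : ℂ | 0 ≤ z.im} := isClosed_le continuous_const Complex.continuous_im
  have hcomp : CompactSpace {z : {z : ℂ // 0 ≤ z.im} // (z : ℂ) ∈ Metric.closedBall c η} :=
    isCompact_iff_compactSpace.1
      (hcl.isClosedEmbedding_subtypeVal.isCompact_preimage (isCompact_closedBall c η))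
  have ha : IsClosedEmbedding
      fun z : {z : {z : ℂ // 0 ≤ z.im} // (z : ℂ) ∈ Metric.closedBall c η} => e z :=
    (he.continuous.comp continuous_subtype_val).isClosedEmbedding
      (he.injective.comp Subtype.val_injective)
  have hopen : IsOpen (e '' {z | (z : ℂ) ∈ Metric.ball c η}) :=
    he.isOpenMap _ (Metric.isOpen_ball.preimage continuous_subtype_val)
  have hb := hopen.isClosed_compl.isClosedEmbedding_subtypeVal
  refine continuous_of_closed_cover ((IsClosedEmbedding.id (X := ℝ)).prodMap ha)
    ((IsClosedEmbedding.id (X := ℝ)).prodMap hb) ?_ ?_ ?_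
  · rw [range_prodMap, range_prodMap, ← prod_union, range_id, Subtype.range_coe]
    convert univ_prod_univ
    rw [eq_univ_iff_forall]
    intro y
    by_cases hy : y ∈ e '' {z | (z : ℂ) ∈ Metric.ball c η}
    · obtain ⟨z, hz, rfl⟩ := hy
      exact .inl ⟨⟨z, Metric.ball_subset_closedBall hz⟩, rfl⟩
    · exact .inr hy
  · simp only [Function.comp_def, Prod.map, id, he.injective.extend_apply]
    refine he.continuous.comp (Continuous.subtype_mk ?_ _)
    have := continuous_pushShift c η
    have h2 : Continuous fun p : ℝ × {z : {z : ℂ // 0 ≤ z.im} // (z : ℂ) ∈ Metric.closedBall c η} =>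
        pushShift c η p.1 p.2 := this.comp (f := fun p : ℝ × {z : {z : ℂ // 0 ≤ z.im} //
          (z : ℂ) ∈ Metric.closedBall c η} => (p.1, ((p.2 : {z : ℂ // 0 ≤ z.im}) : ℂ))) (by fun_prop)
    fun_prop
  · have : ∀ p : ℝ × ((e '' {z | (z : ℂ) ∈ Metric.ball c η})ᶜ : Set X),
        Function.extend e (e ∘ halfPlanePush c η p.1) id (p.2 : X) = p.2 :=
      fun p => extend_push_of_notMem he.injective _ p.2.2
    simp only [Function.comp_def, Prod.map]
    exact (continuous_subtype_val.comp continuous_snd).congr fun p => (this p).symm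

theorem extend_bijective {X : Type*} {e : {z : ℂ // 0 ≤ z.im} → X} (he : Function.Injective e)
    {κ : {z : ℂ // 0 ≤ z.im} → {z : ℂ // 0 ≤ z.im}}
    (hκ : Function.Bijective κ) : Function.Bijective (Function.extend e (e ∘ κ) id) := by
  constructor
  · intro x y h
    by_cases hx : ∃ z, e z = x <;> by_cases hy : ∃ z, e z = y
    · obtain ⟨z, rfl⟩ := hx
      obtain ⟨w, rfl⟩ := hy
      rw [he.extend_apply, he.extend_apply] at h
      rw [hκ.1 (he h)]
    · obtain ⟨z, rfl⟩ := hx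
      rw [he.extend_apply, Function.extend_apply' _ _ _ hy] at h
      exact absurd ⟨_, h⟩ hy
    · obtain ⟨z, rfl⟩ := hy
      rw [he.extend_apply, Function.extend_apply' _ _ _ hx] at h
      exact absurd ⟨_, h.symm⟩ hx
    · rwa [Function.extend_apply' _ _ _ hx, Function.extend_apply' _ _ _ hy] at h
  · intro y
    by_cases hy : ∃ z, e z = y
    · obtain ⟨z, rfl⟩ := hy
      obtain ⟨w, rfl⟩ := hκ.2 z
      exact ⟨e w, he.extend_apply _ _ _⟩
    · exact ⟨y, Function.extend_apply' _ _ _ hy⟩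

theorem exists_push {X : Type*} [TopologicalSpace X] [CompactSpace X] [T2Space X]
    {e : {z : ℂ // 0 ≤ z.im} → X} (he : IsOpenEmbedding e) (c : ℂ) (η σ : ℝ) (hσ : |σ| ≤ 1) :
    ∃ k : X ≃ₜ X, IsIsotopicToId (e '' {z | (z : ℂ) ∈ Metric.ball c η}) k ∧
      ∀ z, k (e z) = e (halfPlanePush c η σ z) := by
  have hb : ∀ t : unitInterval, |(t : ℝ) * σ| ≤ 1 := fun t => by
    rw [abs_mul, abs_of_nonneg t.2.1]
    exact mul_le_one₀ t.2.2 (abs_nonneg _) hσ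
  have hbij := fun t => extend_bijective he.injective (halfPlanePush_bijective c η (hb t))
  have hcont := continuous_extend_push he c η
  set F : unitInterval → X ≃ₜ X := fun t =>
    Continuous.homeoOfEquivCompactToT2 (f := Equiv.ofBijective _ (hbij t))
      (hcont.comp (f := fun x => ((t : ℝ) * σ, x)) (by fun_prop)) with hF
  have hFa : ∀ t x, F t x = Function.extend e (e ∘ halfPlanePush c η (t * σ)) id x := fun _ _ => rfl
  refine ⟨F 1, ⟨F, ?_, ?_, rfl, fun t x hx => ?_⟩, fun z => ?_⟩
  · exact hcont.comp (f := fun p : unitInterval × X => ((p.1 : ℝ) * σ, p.2)) (by fun_prop)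
  · ext x
    rw [hFa]
    by_cases h : ∃ z, e z = x
    · obtain ⟨z, rfl⟩ := h
      rw [he.injective.extend_apply]
      simp [halfPlanePush, pushShift]
    · rw [Function.extend_apply' _ _ _ h]
      rfl
  · rw [hFa]
    exact extend_push_of_notMem he.injective _ hx
  · rw [hFa, he.injective.extend_apply]
    simp

theorem im_eq_zero_of_not_isInteriorPt {X : Type u} [TopologicalSpace X]
    {e : {z : ℂ // 0 ≤ z.im} → X} (he : IsOpenEmbedding e)
    {z : {z : ℂ // 0 ≤ z.im}} (hz : ¬ IsInteriorPt (e z)) : z.1.im = 0 := by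
  by_contra h
  obtain ⟨δ, hδ, w, hw⟩ := isOpenEmbedding_halfPlane_univBall z h
  exact hz ⟨e ∘ δ, he.comp hδ, w, by simp [hw]⟩

/-- A chart may traverse a boundary arc in either direction; `σ = ±1` records which. -/
theorem exists_sign_strictMonoOn {g : ℝ → ℝ} {a b : ℝ} (hab : a ≤ b)
    (hc : ContinuousOn g (Icc a b)) (hi : InjOn g (Icc a b)) :
    ∃ σ : ℝ, σ * σ = 1 ∧ StrictMonoOn (fun t => σ * g t) (Icc a b) := by
  rcases hc.strictMonoOn_of_injOn_Icc' hab hi with h | h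
  · exact ⟨1, by norm_num, by simpa using h⟩
  · refine ⟨-1, by norm_num, fun x hx y hy hxy => ?_⟩
    have := h hx hy hxy
    simp only [neg_mul, one_mul]
    linarith

/-! ### Shrinking boundary arcs -/

section Shrink

variable {X : Type u} [TopologicalSpace X] [CompactSpace X] [T2Space X]

/-- In a half-plane chart at `γ s` the arc runs monotonically along the real axis. A push against
its direction takes points slightly beyond `s` to before `s`, keeping the arc within itself. -/
theorem exists_local_shrink {γ : ℝ → X} (hγ : Continuous γ) {a b : ℝ} (hi : InjOn γ (Icc a b))
    (hbd : ∀ t ∈ Icc a b, ¬ IsInteriorPt (γ t)) {N : Set X} (hN : IsOpen N)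
    {s : ℝ} (hs : s ∈ Ioc a b) (hsN : γ s ∈ N) (hh : HasHalfPlaneNhd (γ s)) :
    ∃ s₁ s₂ : ℝ, a < s₁ ∧ s₁ < s ∧ s < s₂ ∧ ∃ k : X ≃ₜ X, IsIsotopicToId N k ∧
      ∀ t ∈ Icc a b, t < s₂ → k (γ t) ∈ γ '' Icc a s₁ := by
  obtain ⟨e, he, c, hc⟩ := hh
  have hne : Nonempty {z : ℂ // 0 ≤ z.im} := ⟨c⟩
  have him : ∀ z, e z ∈ γ '' Icc a b → z.1.im = 0 := by
    rintro z ⟨t, ht, h⟩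
    exact im_eq_zero_of_not_isInteriorPt he (h ▸ hbd t ht)
  have hc0 : c.1.im = 0 := him c ⟨s, ⟨hs.1.le, hs.2⟩, hc.symm⟩
  obtain ⟨δ₀, hδ₀, hsub₀⟩ := Metric.nhds_basis_closedBall.mem_iff.1
    (hγ.continuousAt (x := s) (he.isOpen_range.mem_nhds ⟨c, hc⟩))
  obtain ⟨δ, hδ, hδa, hδδ⟩ : ∃ δ > 0, a < s - δ ∧ δ ≤ δ₀ :=
    ⟨min δ₀ ((s - a) / 2), lt_min hδ₀ (by linarith [hs.1]), by
      linarith [min_le_right δ₀ ((s - a) / 2), hs.1], min_le_left _ _⟩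
  set J := Icc (s - δ) (min (s + δ) b) with hJ
  have hJab : J ⊆ Icc a b := fun t ht => ⟨hδa.le.trans ht.1, ht.2.trans (min_le_right _ _)⟩
  have hJr : ∀ t ∈ J, γ t ∈ range e := fun t ht => hsub₀ (by
    rw [Metric.mem_closedBall, Real.dist_eq, abs_le]
    have := ht.2.trans (min_le_left _ _)
    constructor <;> linarith [ht.1])
  have hsJ : s ∈ J := ⟨by linarith, le_min (by linarith) hs.2⟩
  set g : ℝ → ℝ := fun t => (Function.invFun e (γ t)).1.re with hg
  have hinv : ∀ t ∈ J, e (Function.invFun e (γ t)) = γ t := fun t ht =>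
    Function.invFun_eq (hJr t ht)
  have hinvg : ∀ t ∈ J, (Function.invFun e (γ t)).1 = (g t : ℂ) := fun t ht =>
    Complex.ext (by simp [hg]) (by
      simpa using him _ ⟨t, hJab ht, (hinv t ht).symm⟩)
  have hgc : ContinuousOn g J := Complex.continuous_re.comp_continuousOn
    (continuous_subtype_val.comp_continuousOn (he.continuousOn_invFun.comp hγ.continuousOn hJr))
  have hgi : InjOn g J := by
    intro t ht t' ht' h
    refine hi (hJab ht) (hJab ht') ?_
    rw [← hinv t ht, ← hinv t' ht']
    congr 1
    apply Subtype.ext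
    rw [hinvg t ht, hinvg t' ht', h]
  have hgs : c.1 = (g s : ℂ) := by
    rw [← hinvg s hsJ, ← hc, Function.leftInverse_invFun he.injective]
  obtain ⟨σ, hσ, hmono⟩ := exists_sign_strictMonoOn (hsJ.1.trans hsJ.2) hgc hgi
  have hCc : IsClosed (γ '' Icc a (s - δ)) := (isCompact_Icc.image hγ).isClosed
  have hcC : e c ∉ γ '' Icc a (s - δ) := by
    rintro ⟨t, ht, h⟩
    have := hi ⟨ht.1, by linarith [ht.2, hs.2]⟩ ⟨hs.1.le, hs.2⟩ (h.trans hc)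
    linarith [ht.2]
  -- The ball of the push lies over `N` and misses the initial piece `γ '' Icc a (s - δ)`, which is
  -- therefore fixed.
  obtain ⟨η, hη, hηs⟩ := Metric.nhds_basis_ball.mem_iff.1 (he.continuous.continuousAt (x := c)
    ((hN.inter hCc.isOpen_compl).mem_nhds ⟨hc ▸ hsN, hcC⟩))
  have hσ1 : |σ| ≤ 1 := by
    have : |σ| * |σ| = 1 := by rw [← abs_mul, hσ, abs_one]
    nlinarith [abs_nonneg σ]
  have hσd : ∀ x y : ℝ, |x - y| = |σ * x - σ * y| := by
    intro x y
    rw [← mul_sub, abs_mul]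
    have : |σ| * |σ| = 1 := by rw [← abs_mul, hσ, abs_one]
    have : |σ| = 1 := by nlinarith [abs_nonneg σ]
    rw [this, one_mul]
  obtain ⟨k, hk, hke⟩ := exists_push he c.1 η σ hσ1
  -- Within `η / 6` of the centre the push moves by at least `5η / 12`, so it lands at relative
  -- coordinate at most `-η / 4`, which is before `γ (s - ε)`, at more than `-η / 6`.
  obtain ⟨ε₀, hε₀, hεs⟩ := Metric.continuousOn_iff.1 hgc s hsJ (η / 6) (by positivity)
  obtain ⟨ε, hε, hεδ, hεε⟩ : ∃ ε > 0, ε < δ ∧ ε < ε₀ :=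
    ⟨min δ ε₀ / 2, by positivity, by linarith [min_le_left δ ε₀], by linarith [min_le_right δ ε₀]⟩
  have hclose : ∀ t ∈ J, |t - s| ≤ ε → |σ * g t - σ * g s| < η / 6 := fun t ht h => by
    rw [← hσd]
    exact hεs t ht (h.trans_lt hεε)
  refine ⟨s - ε, s + ε, by linarith, by linarith, by linarith, k, hk.mono ?_, fun t ht hts => ?_⟩
  · rintro _ ⟨z, hz, rfl⟩
    exact (hηs (show z ∈ Metric.ball c η from hz)).1
  by_cases htδ : t ≤ s - δ
  · rw [hk.apply_of_notMem]
    · exact ⟨t, ⟨ht.1, by linarith⟩, rfl⟩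
    · rintro ⟨z, hz, h⟩
      exact (hηs (show z ∈ Metric.ball c η from hz)).2 (h ▸ ⟨t, ⟨ht.1, htδ⟩, rfl⟩)
  rw [not_le] at htδ
  have htJ : t ∈ J := ⟨htδ.le, le_min (by linarith) ht.2⟩
  have hs1J : s - ε ∈ J := ⟨by linarith, le_min (by linarith) (by linarith [hs.2])⟩
  have hsδJ : s - δ ∈ J := ⟨le_rfl, le_min (by linarith) (by linarith [hs.2])⟩
  set d := σ * g t - σ * g s with hd
  set y := g t - σ * (max 0 (η - |g t - g s|) / 2) with hy
  have hpush : ∀ z, z.1 = (y : ℂ) → k (γ t) = e z := by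
    intro z hz
    rw [← hinv t htJ, hke]
    congr 1
    apply Subtype.ext
    change (Function.invFun e (γ t)).1 - (pushShift c.1 η σ (Function.invFun e (γ t)).1 : ℂ) = _
    have hdist : dist (g t : ℂ) (g s : ℂ) = |g t - g s| := by
      rw [Complex.dist_eq, ← Complex.ofReal_sub, Complex.norm_real, Real.norm_eq_abs]
    rw [hz, hinvg t htJ, pushShift, hgs, hdist, hy]
    push_cast
    ring
  have hσy : σ * y - σ * g s = d - max 0 (η - |d|) / 2 := by
    rw [hy, hd, hσd (g t)]
    linear_combination (-(max 0 (η - |σ * g t - σ * g s|) / 2)) * hσ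
  have hd1 : d ≤ η / 6 := by
    by_cases h : t ≤ s
    · have : σ * g t ≤ σ * g s := hmono.monotoneOn htJ hsJ h
      linarith
    · rw [not_le] at h
      have := hclose t htJ (by rw [abs_le]; constructor <;> linarith)
      linarith [le_abs_self (σ * g t - σ * g s)]
  have hup : σ * y ≤ σ * g (s - ε) := by
    have h1 := hclose (s - ε) hs1J (by rw [abs_le]; constructor <;> linarith)
    have h2 := neg_abs_le (σ * g (s - ε) - σ * g s)
    have h3 := le_max_right 0 (η - |d|)
    have h4 : |d| ≤ η / 6 ∨ |d| = -d := by
      rcases abs_cases d with h | h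
      · left; linarith
      · right; exact h.1
    rcases h4 with h4 | h4
    · linarith [le_abs_self d]
    · rw [h4] at h3
      have : d ≤ 0 := by rw [← neg_nonneg, ← h4]; exact abs_nonneg d
      rw [h4] at hσy
      linarith
  -- The point `γ (s - δ)` is outside the ball, at relative coordinate at most `-η`, and the push
  -- does not move points of the ball past `-η`.
  have hlow : σ * g (s - δ) ≤ σ * y := by
    have h1 : η ≤ |g (s - δ) - g s| := by
      by_contra h
      rw [not_le] at h
      refine (hηs (show Function.invFun e (γ (s - δ)) ∈ Metric.ball c η from ?_)).2
        ((hinv _ hsδJ).symm ▸ ⟨s - δ, ⟨hδa.le, le_rfl⟩, rfl⟩)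
      rw [Metric.mem_ball, Subtype.dist_eq, hinvg _ hsδJ, hgs, Complex.dist_eq,
        ← Complex.ofReal_sub, Complex.norm_real]
      exact h
    rw [hσd] at h1
    have h2 : σ * g (s - δ) < σ * g s := hmono hsδJ hsJ (by linarith)
    rw [abs_of_neg (by linarith)] at h1
    have h3 : σ * g (s - δ) ≤ σ * g t := hmono.monotoneOn hsδJ htJ htδ.le
    rcases max_cases 0 (η - |d|) with h | h
    · rw [h.1] at hσy
      linarith
    · rw [h.1] at hσy
      rcases abs_cases d with h' | h' <;> rw [h'.1] at hσy h <;> linarith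
  -- The pushed point lies between two points of the arc on the real axis, hence on the arc.
  obtain ⟨t', ht', hty⟩ := intermediate_value_Icc (show s - δ ≤ s - ε by linarith)
    (ContinuousOn.mono (continuousOn_const.mul hgc : ContinuousOn (fun t => σ * g t) J)
      (fun t ht => ⟨ht.1, ht.2.trans hs1J.2⟩)) ⟨hlow, hup⟩
  have ht'J : t' ∈ J := ⟨ht'.1, ht'.2.trans hs1J.2⟩
  have hyt : g t' = y := by
    have : σ * (σ * g t') = σ * (σ * y) := congrArg (σ * ·) hty
    rwa [← mul_assoc, ← mul_assoc, hσ, one_mul, one_mul] at this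
  refine ⟨t', ⟨by linarith [ht'.1], ht'.2⟩, ?_⟩
  rw [hpush _ (by rw [hinvg t' ht'J, hyt]), hinv t' ht'J]

/-- Consider the infimum of the parameters `s` such that the arc can be shrunk into `γ '' Icc a s`.
If it exceeded `a`, a further local push there would go below it. -/
theorem exists_shrink_to_start {γ : ℝ → X} (hγ : Continuous γ) {a b : ℝ} (hab : a < b)
    (hi : InjOn γ (Icc a b)) (hbd : ∀ t ∈ Icc a b, ¬ IsInteriorPt (γ t))
    (hh : ∀ t ∈ Icc a b, HasHalfPlaneNhd (γ t)) {N : Set X} (hN : IsOpen N)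
    (hγN : ∀ t ∈ Icc a b, γ t ∈ N) {b' : ℝ} (hb' : a < b') :
    ∃ k : X ≃ₜ X, IsIsotopicToId N k ∧ ∀ t ∈ Icc a b, k (γ t) ∈ γ '' Icc a b' := by
  set P : Set ℝ := {s | s ∈ Ioc a b ∧ ∃ k : X ≃ₜ X, IsIsotopicToId N k ∧
    ∀ t ∈ Icc a b, k (γ t) ∈ γ '' Icc a s} with hP
  have hbP : b ∈ P := ⟨⟨hab, le_rfl⟩, Homeomorph.refl X, .refl N, fun t ht => ⟨t, ht, rfl⟩⟩
  have hbb : BddBelow P := ⟨a, fun s hs => hs.1.1.le⟩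
  have ham : a ≤ sInf P := le_csInf ⟨b, hbP⟩ fun s hs => hs.1.1.le
  have hmb : sInf P ≤ b := csInf_le hbb hbP
  have hm : sInf P = a := by
    by_contra hne
    have hlt : a < sInf P := lt_of_le_of_ne ham (Ne.symm hne)
    obtain ⟨s₁, s₂, h1, h2, h3, k, hk, hkγ⟩ := exists_local_shrink hγ hi hbd hN ⟨hlt, hmb⟩
      (hγN _ ⟨ham, hmb⟩) (hh _ ⟨ham, hmb⟩)
    obtain ⟨s, ⟨hs, k', hk', hkγ'⟩, hss⟩ := exists_lt_of_csInf_lt ⟨b, hbP⟩ h3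
    have : s₁ ∈ P := by
      refine ⟨⟨h1, by linarith⟩, k'.trans k, hk'.trans hk, fun t ht => ?_⟩
      obtain ⟨t', ht', h⟩ := hkγ' t ht
      rw [Homeomorph.trans_apply, ← h]
      exact hkγ t' ⟨ht'.1, ht'.2.trans hs.2⟩ (ht'.2.trans_lt hss)
    linarith [csInf_le hbb this]
  obtain ⟨s, ⟨-, k, hk, hkγ⟩, hs⟩ := exists_lt_of_csInf_lt ⟨b, hbP⟩ (hm.trans_lt hb')
  exact ⟨k, hk, fun t ht => image_mono (Icc_subset_Icc_right hs.le) (hkγ t ht)⟩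

/-- A boundary arc can be shrunk into any neighbourhood of one of its points. -/
theorem exists_shrink {γ : ℝ → X} (hγ : Continuous γ) {a b : ℝ}
    (hi : InjOn γ (Icc a b)) (hbd : ∀ t ∈ Icc a b, ¬ IsInteriorPt (γ t))
    (hh : ∀ t ∈ Icc a b, HasHalfPlaneNhd (γ t)) {N : Set X} (hN : IsOpen N)
    (hγN : ∀ t ∈ Icc a b, γ t ∈ N) {s : ℝ} (hs : s ∈ Ioo a b) {O : Set X} (hO : IsOpen O)
    (hsO : γ s ∈ O) :
    ∃ k : X ≃ₜ X, IsIsotopicToId N k ∧ ∀ t ∈ Icc a b, k (γ t) ∈ O := by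
  obtain ⟨ε₀, hε₀, h₀⟩ := Metric.nhds_basis_closedBall.mem_iff.1
    (hγ.continuousAt (x := s) (hO.mem_nhds hsO))
  obtain ⟨ε, hε, hεε, hεb⟩ : ∃ ε > 0, ε ≤ ε₀ ∧ ε ≤ b - s :=
    ⟨min ε₀ (b - s), lt_min hε₀ (by linarith [hs.2]), min_le_left _ _, min_le_right _ _⟩
  obtain ⟨k, hk, hkγ⟩ := exists_shrink_to_start hγ (hs.1.trans hs.2) hi hbd hh hN hγN
    (b' := s + ε) (by linarith [hs.1])
  have hm : ∀ t ∈ Icc (-(s + ε)) (-a), -t ∈ Icc a b := fun t ht =>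
    ⟨by linarith [ht.2], by linarith [ht.1]⟩
  -- The same shrinking applied to the reversed arc trims the other end, leaving `γ '' Icc (s - ε)
  -- (s + ε)`.
  obtain ⟨k', hk', hkγ'⟩ := exists_shrink_to_start (γ := fun t => γ (-t)) (by fun_prop)
    (a := -(s + ε)) (b := -a) (by linarith [hs.1])
    (fun x hx y hy h => neg_injective (hi (hm x hx) (hm y hy) h)) (fun t ht => hbd _ (hm t ht))
    (fun t ht => hh _ (hm t ht)) hN (fun t ht => hγN _ (hm t ht)) (b' := -(s - ε)) (by linarith)
  refine ⟨k.trans k', hk.trans hk', fun t ht => ?_⟩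
  obtain ⟨t', ht', h⟩ := hkγ t ht
  rw [Homeomorph.trans_apply, ← h]
  obtain ⟨t'', ht'', h'⟩ := hkγ' (-t') ⟨by linarith [ht'.2], by linarith [ht'.1]⟩
  simp only [neg_neg] at h'
  rw [← h']
  refine h₀ ?_
  rw [Metric.mem_closedBall, Real.dist_eq, abs_le]
  constructor <;> linarith [ht''.1, ht''.2]

end Shrink

namespace OrientedSurface.OneHandle

variable {S M : OrientedSurface.{u}} (H : OneHandle S M)

/-- The end `{i} × [0, 1]` of the handle, `i = 0, 1`, as an arc in the boundary. -/
theorem exists_attachingArc {i : unitInterval} (hi : i = 0 ∨ i = 1) :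
    ∃ γ : ℝ → S, Continuous γ ∧ InjOn γ (Icc 0 1) ∧ (∀ t, γ t ∈ S.boundary) ∧
      ∀ t, H.incl (γ t) = H.handle (i, projIcc 0 1 zero_le_one t) := by
  have h : ∀ t : ℝ, ∃ x ∈ S.boundary, H.incl x = H.handle (i, projIcc 0 1 zero_le_one t) := by
    rcases hi with rfl | rfl
    · exact fun t => H.attach_zero _
    · exact fun t => H.attach_one _
  choose γ h1 h2 using h
  refine ⟨γ, ?_, ?_, h1, h2⟩
  · rw [H.isClosedEmbedding_incl.isInducing.continuous_iff]
    exact (H.continuous_handle.comp (by fun_prop)).congr fun t => (h2 t).symm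
  · intro s hs t ht hst
    have := congrArg H.incl hst
    rw [h2, h2] at this
    have := congrArg Prod.snd (H.injective_handle this)
    simp only at this
    rwa [projIcc_of_mem _ hs, projIcc_of_mem _ ht, Subtype.mk.injEq] at this

/-- Away from any finite set there are two points such that the attaching region can be shrunk
into any neighbourhood of them. -/
theorem exists_shrink_attachingRegion (P : Set S) (hP : P.Finite) :
    ∃ Q : Set S, Q.Finite ∧ Disjoint P Q ∧ ∀ O : Set S, IsOpen O → Q ⊆ O →
      ∃ k : S ≃ₜ S, IsIsotopicToId univ k ∧ ∀ x ∈ H.attachingRegion, k x ∈ O := by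
  obtain ⟨γ₀, hc₀, hi₀, hb₀, h₀⟩ := H.exists_attachingArc (i := 0) (.inl rfl)
  obtain ⟨γ₁, hc₁, hi₁, hb₁, h₁⟩ := H.exists_attachingArc (i := 1) (.inr rfl)
  have hpt : ∀ γ : ℝ → S, InjOn γ (Icc 0 1) → ∃ s ∈ Ioo (0 : ℝ) 1, γ s ∉ P := by
    intro γ hi
    -- The open arc is infinite, so it has a point off the finite set `P`.
    have hinf : (γ '' Ioo (0 : ℝ) 1).Infinite :=
      (Ioo_infinite zero_lt_one).image (hi.mono Ioo_subset_Icc_self)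
    obtain ⟨_, ⟨s, hs, rfl⟩, h⟩ := hinf.exists_notMem_finset hP.toFinset
    exact ⟨s, hs, by simpa using h⟩
  obtain ⟨s₀, hs₀, hp₀⟩ := hpt γ₀ hi₀
  obtain ⟨s₁, hs₁, hp₁⟩ := hpt γ₁ hi₁
  refine ⟨{γ₀ s₀, γ₁ s₁}, by simp, by simp [hp₀, hp₁], fun O hO hQ => ?_⟩
  have hdisj : Disjoint (γ₀ '' Icc 0 1) (γ₁ '' Icc 0 1) := by
    rw [disjoint_left]
    rintro _ ⟨s, -, rfl⟩ ⟨t, -, h⟩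
    have := congrArg H.incl h
    rw [h₀, h₁] at this
    have := congrArg Prod.fst (H.injective_handle this)
    exact zero_ne_one this.symm
  obtain ⟨N₀, N₁, hN₀, hN₁, hγ₀, hγ₁, hN⟩ := SeparatedNhds.of_isCompact_isCompact
    (isCompact_Icc.image hc₀) (isCompact_Icc.image hc₁) hdisj
  have hhalf : ∀ x ∈ S.boundary, HasHalfPlaneNhd x := fun x hx =>
    (S.locally_half_plane x).resolve_left hx
  -- The first foot is kept inside `N₀`, where the push of the second foot is the identity, so the
  -- two pushes do not interfere.
  obtain ⟨k₀, hk₀, hkO₀⟩ := exists_shrink hc₀ hi₀ (fun t _ => hb₀ t) (fun t _ => hhalf _ (hb₀ t))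
    hN₀ (fun t ht => hγ₀ ⟨t, ht, rfl⟩) hs₀ (hO.inter hN₀)
    ⟨hQ (by simp), hγ₀ ⟨s₀, Ioo_subset_Icc_self hs₀, rfl⟩⟩
  obtain ⟨k₁, hk₁, hkO₁⟩ := exists_shrink hc₁ hi₁ (fun t _ => hb₁ t) (fun t _ => hhalf _ (hb₁ t))
    hN₁ (fun t ht => hγ₁ ⟨t, ht, rfl⟩) hs₁ hO (hQ (by simp))
  refine ⟨k₀.trans k₁, (hk₀.mono (subset_univ _)).trans (hk₁.mono (subset_univ _)), ?_⟩
  rintro x ⟨⟨s, t⟩, hst⟩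
  rw [Homeomorph.trans_apply]
  rcases H.attach_only x s t hst.symm with rfl | rfl
  · have : x = γ₀ t := H.injective_incl (by rw [h₀, ← hst, projIcc_val])
    have h := hkO₀ t t.2
    rw [this, hk₁.apply_of_notMem (disjoint_left.1 hN h.2)]
    exact h.1
  · have : x = γ₁ t := H.injective_incl (by rw [h₁, ← hst, projIcc_val])
    rw [this, hk₀.apply_of_notMem (disjoint_right.1 hN (hγ₁ ⟨t, t.2, rfl⟩))]
    exact hkO₁ t t.2

end OrientedSurface.OneHandle

/-! ### Gluing two compact Hausdorff spaces along a closed subspace -/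

/-- The union of `X` and `Y` along the common subspace `S`. -/
def Gluing {S X Y : Type u} (_ : S → X) (g : S → Y) : Type u := X ⊕ {y : Y // y ∉ range g}

namespace Gluing

variable {S X Y : Type u} {f : S → X} {g : S → Y}

/-- The inclusion of the first piece. -/
def left (f : S → X) (g : S → Y) (x : X) : Gluing f g := Sum.inl x

/-- The inclusion of the part of the second piece off the first. -/
def rightOnly (f : S → X) (g : S → Y) (y : {y : Y // y ∉ range g}) : Gluing f g := Sum.inr y

open Classical in
/-- The inclusion of the second piece. -/
noncomputable def right (f : S → X) (g : S → Y) (y : Y) : Gluing f g :=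
  if h : y ∈ range g then left f g (f (mem_range.1 h).choose) else rightOnly f g ⟨y, h⟩

theorem left_injective : Function.Injective (left f g) := Sum.inl_injective

theorem right_apply (hg : Function.Injective g) (s : S) : right f g (g s) = left f g (f s) := by
  have h : g s ∈ range g := ⟨s, rfl⟩
  rw [right, dif_pos h, hg (mem_range.1 h).choose_spec]

theorem right_of_notMem {y : Y} (h : y ∉ range g) : right f g y = rightOnly f g ⟨y, h⟩ := dif_neg h

theorem left_eq_right_iff (hg : Function.Injective g) {x : X} {y : Y} :
    left f g x = right f g y ↔ ∃ s, x = f s ∧ y = g s := by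
  constructor
  · intro h
    by_cases hy : y ∈ range g
    · obtain ⟨s, rfl⟩ := hy
      rw [right_apply hg] at h
      exact ⟨s, left_injective h, rfl⟩
    · rw [right_of_notMem hy] at h
      exact absurd h Sum.inl_ne_inr
  · rintro ⟨s, rfl, rfl⟩
    exact (right_apply hg s).symm

theorem right_injective (hf : Function.Injective f) (hg : Function.Injective g) :
    Function.Injective (right f g) := by
  intro y y' h
  by_cases hy : y ∈ range g
  · obtain ⟨s, rfl⟩ := hy
    rw [right_apply hg] at h
    obtain ⟨s', h1, rfl⟩ := (left_eq_right_iff hg).1 h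
    rw [hf h1]
  · by_cases hy' : y' ∈ range g
    · obtain ⟨s, rfl⟩ := hy'
      rw [right_apply hg] at h
      obtain ⟨s', h1, rfl⟩ := (left_eq_right_iff hg).1 h.symm
      rw [hf h1]
    · rw [right_of_notMem hy, right_of_notMem hy'] at h
      exact congrArg Subtype.val (Sum.inr_injective h)

theorem range_left_union_range_right : range (left f g) ∪ range (right f g) = univ := by
  rw [eq_univ_iff_forall]
  rintro (x | ⟨y, hy⟩)
  · exact .inl ⟨x, rfl⟩
  · exact .inr ⟨y, right_of_notMem hy⟩

variable [TopologicalSpace X] [TopologicalSpace Y]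

noncomputable instance : TopologicalSpace (Gluing f g) :=
  .coinduced (left f g) inferInstance ⊔ .coinduced (right f g) inferInstance

theorem isClosed_iff {C : Set (Gluing f g)} :
    IsClosed C ↔ IsClosed (left f g ⁻¹' C) ∧ IsClosed (right f g ⁻¹' C) := by
  rw [← isOpen_compl_iff, ← isOpen_compl_iff, ← isOpen_compl_iff]
  exact Iff.rfl

theorem continuous_left : Continuous (left f g) :=
  continuous_iff_isClosed.2 fun _ h => (isClosed_iff.1 h).1

theorem continuous_right : Continuous (right f g) :=
  continuous_iff_isClosed.2 fun _ h => (isClosed_iff.1 h).2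

theorem isClosedEmbedding_left [TopologicalSpace S] (hf : Continuous f) (hg : IsClosedEmbedding g) :
    IsClosedEmbedding (left f g) := by
  refine .of_continuous_injective_isClosedMap continuous_left left_injective fun C hC => ?_
  refine isClosed_iff.2 ⟨by rwa [preimage_image_eq _ left_injective], ?_⟩
  have : right f g ⁻¹' (left f g '' C) = g '' (f ⁻¹' C) := by
    ext y
    constructor
    · rintro ⟨x, hx, h⟩
      obtain ⟨s, rfl, rfl⟩ := (left_eq_right_iff hg.injective).1 h
      exact ⟨s, hx, rfl⟩
    · rintro ⟨s, hs, rfl⟩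
      exact ⟨f s, hs, (right_apply hg.injective s).symm⟩
  rw [this]
  exact hg.isClosedMap _ (hC.preimage hf)

theorem isClosedEmbedding_right [TopologicalSpace S] (hf : IsClosedEmbedding f) (hg : IsClosedEmbedding g) :
    IsClosedEmbedding (right f g) := by
  refine .of_continuous_injective_isClosedMap continuous_right
    (right_injective hf.injective hg.injective) fun C hC => ?_
  refine isClosed_iff.2
    ⟨?_, by rwa [preimage_image_eq _ (right_injective hf.injective hg.injective)]⟩
  have : left f g ⁻¹' (right f g '' C) = f '' (g ⁻¹' C) := by
    ext x
    constructor
    · rintro ⟨y, hy, h⟩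
      obtain ⟨s, rfl, rfl⟩ := (left_eq_right_iff hg.injective).1 h.symm
      exact ⟨s, hy, rfl⟩
    · rintro ⟨s, hs, rfl⟩
      exact ⟨g s, hs, right_apply hg.injective s⟩
  rw [this]
  exact hf.isClosedMap _ (hC.preimage hg.continuous)

instance [CompactSpace X] [CompactSpace Y] : CompactSpace (Gluing f g) :=
  ⟨range_left_union_range_right ▸ (isCompact_range continuous_left).union
    (isCompact_range continuous_right)⟩

theorem exists_desc (hg : Function.Injective g) (a : C(X, ℝ)) (b : C(Y, ℝ))
    (h : ∀ s, a (f s) = b (g s)) :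
    ∃ c : C(Gluing f g, ℝ), (∀ x, c (left f g x) = a x) ∧ ∀ y, c (right f g y) = b y := by
  set c : Gluing f g → ℝ := Sum.elim a fun y => b y
  have h1 : ∀ x, c (left f g x) = a x := fun x => rfl
  have h2 : ∀ y, c (right f g y) = b y := by
    intro y
    by_cases hy : y ∈ range g
    · obtain ⟨s, rfl⟩ := hy
      rw [right_apply hg, h1, h]
    · rw [right_of_notMem hy]
      rfl
  refine ⟨⟨c, continuous_iff_isClosed.2 fun C hC => isClosed_iff.2 ⟨?_, ?_⟩⟩, h1, h2⟩
  · exact hC.preimage (a.continuous.congr fun x => (h1 x).symm)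
  · exact hC.preimage (b.continuous.congr fun x => (h2 x).symm)

theorem exists_ne_of_ne {X : Type*} [TopologicalSpace X] [CompactSpace X] [T2Space X] {x x' : X}
    (h : x ≠ x') : ∃ a : C(X, ℝ), a x ≠ a x' := by
  obtain ⟨a, h0, h1, -⟩ := exists_continuous_zero_one_of_isClosed (isClosed_singleton (x := x))
    (isClosed_singleton (x := x')) (by simpa using h)
  refine ⟨a, ?_⟩
  rw [h0 rfl, h1 rfl]
  exact zero_ne_one

/-- Real-valued continuous functions separate points. Tietze extends a function from one piece
across the other; for a point of `Y` off `S` and a point of `X`, a Urysohn function vanishing on `S`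
is extended by zero. -/
theorem t2Space [TopologicalSpace S] [CompactSpace X] [T2Space X] [CompactSpace Y] [T2Space Y]
    (hf : IsClosedEmbedding f) (hg : IsClosedEmbedding g) : T2Space (Gluing f g) := by
  suffices h : ∀ z z' : Gluing f g, z ≠ z' → ∃ c : C(Gluing f g, ℝ), c z ≠ c z' by
    refine ⟨fun z z' hz => ?_⟩
    obtain ⟨c, hc⟩ := h z z' hz
    exact separated_by_continuous c.continuous hc
  have hLL : ∀ x x', left f g x ≠ left f g x' → ∃ c : C(Gluing f g, ℝ),
      c (left f g x) ≠ c (left f g x') := by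
    intro x x' h
    obtain ⟨a, ha⟩ := exists_ne_of_ne fun h' => h (congrArg _ h')
    obtain ⟨b, hb⟩ := ContinuousMap.exists_extension hg (a.comp ⟨f, hf.continuous⟩)
    obtain ⟨c, h1, h2⟩ := exists_desc (f := f) hg.injective a b
      fun s => (DFunLike.congr_fun hb s).symm
    exact ⟨c, by rwa [h1, h1]⟩
  have hRR : ∀ y y', right f g y ≠ right f g y' → ∃ c : C(Gluing f g, ℝ),
      c (right f g y) ≠ c (right f g y') := by
    intro x x' h
    obtain ⟨b, hb⟩ := exists_ne_of_ne fun h' => h (congrArg _ h')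
    obtain ⟨a, ha⟩ := ContinuousMap.exists_extension hf (b.comp ⟨g, hg.continuous⟩)
    obtain ⟨c, h1, h2⟩ := exists_desc (f := f) hg.injective a b fun s => DFunLike.congr_fun ha s
    exact ⟨c, by rwa [h2, h2]⟩
  have hLR : ∀ x y, left f g x ≠ right f g y → ∃ c : C(Gluing f g, ℝ),
      c (left f g x) ≠ c (right f g y) := by
    intro x y h
    by_cases hy : y ∈ range g
    · obtain ⟨s, rfl⟩ := hy
      rw [right_apply hg.injective] at h ⊢
      exact hLL _ _ h
    · obtain ⟨b, h0, h1, -⟩ := exists_continuous_zero_one_of_isClosed hg.isClosed_range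
        (isClosed_singleton (x := y)) (by simpa using hy)
      obtain ⟨c, hc1, hc2⟩ := exists_desc (f := f) hg.injective 0 b fun s => (h0 ⟨s, rfl⟩).symm
      refine ⟨c, ?_⟩
      rw [hc1, hc2, h1 rfl]
      exact zero_ne_one
  intro z z' h
  rcases (range_left_union_range_right ▸ mem_univ z : z ∈ range (left f g) ∪ range (right f g))
    with ⟨x, rfl⟩ | ⟨x, rfl⟩ <;>
  rcases (range_left_union_range_right ▸ mem_univ z' : z' ∈ range (left f g) ∪ range (right f g))
    with ⟨y, rfl⟩ | ⟨y, rfl⟩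
  · exact hLL x y h
  · exact hLR x y h
  · obtain ⟨c, hc⟩ := hLR y x h.symm
    exact ⟨c, hc.symm⟩
  · exact hRR x y h

end Gluing

/-! ### Attaching two handles simultaneously -/

namespace OrientedSurface

/-- `Z` is the union of `M` and `M'`, which are obtained from `S` by attaching the handles of `H`
and `H'`, along `S`. -/
structure Amalgam {S M M' : OrientedSurface.{u}} (H : OneHandle S M) (H' : OneHandle S M')
    (Z : Type u) [TopologicalSpace Z] where
  left : M → Z
  right : M' → Z
  isClosedEmbedding_left : IsClosedEmbedding left
  isClosedEmbedding_right : IsClosedEmbedding right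
  cover : range left ∪ range right = univ
  left_eq_right_iff : ∀ x y, left x = right y ↔ ∃ s, x = H.incl s ∧ y = H'.incl s

namespace Amalgam

variable {S M M' : OrientedSurface.{u}} {H : OneHandle S M} {H' : OneHandle S M'}
  {Z : Type u} [TopologicalSpace Z]

/-- The same amalgam with the roles of the two pieces exchanged. -/
def swap (A : Amalgam H H' Z) : Amalgam H' H Z where
  left := A.right
  right := A.left
  isClosedEmbedding_left := A.isClosedEmbedding_right
  isClosedEmbedding_right := A.isClosedEmbedding_left
  cover := by rw [union_comm, A.cover]
  left_eq_right_iff x y := by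
    rw [eq_comm, A.left_eq_right_iff]
    exact exists_congr fun s => and_comm

variable (A : Amalgam H H' Z)

theorem left_incl (s : S) : A.left (H.incl s) = A.right (H'.incl s) :=
  (A.left_eq_right_iff _ _).2 ⟨s, rfl, rfl⟩

theorem isClosed_range_handle : IsClosed (range (A.right ∘ H'.handle)) :=
  (A.isClosedEmbedding_right.comp H'.isClosedEmbedding_handle).isClosed_range

theorem cover_handle : range A.left ∪ range (A.right ∘ H'.handle) = univ := by
  rw [eq_univ_iff_forall]
  intro z
  rcases (A.cover ▸ mem_univ z : z ∈ range A.left ∪ range A.right) with h | ⟨y, rfl⟩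
  · exact .inl h
  · rcases H'.exists_eq y with ⟨s, rfl⟩ | ⟨p, rfl⟩
    · exact .inl ⟨H.incl s, A.left_incl s⟩
    · exact .inr ⟨p, rfl⟩

theorem isInteriorPt_left_iff {x : M} (hx : A.left x ∉ range (A.right ∘ H'.handle)) :
    IsInteriorPt (A.left x) ↔ IsInteriorPt x :=
  isInteriorPt_iff_of_closed_cover A.isClosedEmbedding_left.isEmbedding A.isClosed_range_handle
    A.cover_handle hx

theorem incl_mem_boundary (hd : Disjoint H.attachingRegion H'.attachingRegion)
    {s : S} (hs : s ∈ H'.attachingRegion) : H.incl s ∈ M.boundary := fun h =>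
  H'.mem_boundary_of_mem_attachingRegion hs
    ((H.isInteriorPt_incl_iff (disjoint_right.1 hd hs)).1 h)

theorem notMem_range_handle (hd : Disjoint H.attachingRegion H'.attachingRegion)
    {x : M} (hx : IsInteriorPt x) :
    A.left x ∉ range (A.right ∘ H'.handle) := by
  rintro ⟨p, hp⟩
  obtain ⟨s, rfl, h⟩ := (A.left_eq_right_iff _ _).1 hp.symm
  exact incl_mem_boundary hd ⟨p, h⟩ hx

theorem handle_notMem_range_handle (hd : Disjoint H.attachingRegion H'.attachingRegion)
    (p : unitInterval × unitInterval) :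
    A.left (H.handle p) ∉ range (A.right ∘ H'.handle) := by
  rintro ⟨q, hq⟩
  obtain ⟨s, h, h'⟩ := (A.left_eq_right_iff _ _).1 hq.symm
  exact disjoint_left.1 hd ⟨p, h⟩ ⟨q, h'⟩

/-- The handles are disjoint, so every point is off one of them and has a neighbourhood inside `M`
or inside `M'`. Local properties of `Z` are inherited in this way. -/
theorem exists_eq_left_or_right (hd : Disjoint H.attachingRegion H'.attachingRegion)
    (z : Z) :
    (∃ x, z = A.left x ∧ z ∉ range (A.right ∘ H'.handle)) ∨
      ∃ y, z = A.right y ∧ z ∉ range (A.left ∘ H.handle) := by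
  by_cases hz : z ∈ range (A.right ∘ H'.handle)
  · obtain ⟨p, rfl⟩ := hz
    exact .inr ⟨_, rfl, A.swap.handle_notMem_range_handle hd.symm p⟩
  · rcases (A.cover_handle ▸ mem_univ z : z ∈ range A.left ∪ _) with ⟨x, rfl⟩ | h
    · exact .inl ⟨x, rfl, hz⟩
    · exact absurd h hz

theorem isOpenEmbedding_left_comp (hd : Disjoint H.attachingRegion H'.attachingRegion)
    {e : ℂ → M} (he : e ∈ M.charts) : IsOpenEmbedding (A.left ∘ e) :=
  isOpenEmbedding_comp_of_closed_cover A.isClosedEmbedding_left.isEmbedding A.isClosed_range_handle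
    A.cover_handle (M.charts_open e he)
    fun z => A.notMem_range_handle hd (isInteriorPt_of_mem_charts he z)

/-- Charts from different pieces meet only over points of `S`. These are interior in `S`, because a
foot of either handle is boundary in the other piece, so a chart of `S` mediates between the two. -/
theorem sameOrientationAt (hd : Disjoint H.attachingRegion H'.attachingRegion)
    {e e' : ℂ → Z} (he : e ∈ (A.left ∘ ·) '' M.charts)
    (he' : e' ∈ (A.left ∘ ·) '' M.charts ∪ (A.right ∘ ·) '' M'.charts) {z w : ℂ}
    (h : e z = e' w) : SameOrientationAt e e' z w := by
  obtain ⟨e, he, rfl⟩ := he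
  rcases he' with ⟨e', he', rfl⟩ | ⟨e', he', rfl⟩
  · exact (M.charts_oriented e he e' he' z w (A.isClosedEmbedding_left.injective h)).comp_left _
  · obtain ⟨s, hs, hs'⟩ := (A.left_eq_right_iff _ _).1 h
    have hint : IsInteriorPt (H.incl s) := hs ▸ isInteriorPt_of_mem_charts he z
    have hint' : IsInteriorPt (H'.incl s) := hs' ▸ isInteriorPt_of_mem_charts he' w
    have hsint : IsInteriorPt s := (H.isInteriorPt_incl_iff fun ha =>
      incl_mem_boundary hd.symm ha hint').1 hint
    obtain ⟨c, hc, v, rfl⟩ := S.charts_cover s hsint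
    have hco := H.isOpenEmbedding_incl_comp (S.charts_open c hc) (isInteriorPt_of_mem_charts hc)
    have h1 := ((H.oriented_incl c hc e he v z hs.symm).symm hco (M.charts_open e he)
      hs.symm).comp_left A.left
    have h2 := (H'.oriented_incl c hc e' he' v w hs'.symm).comp_left A.right
    have heq : A.right ∘ H'.incl ∘ c = A.left ∘ H.incl ∘ c :=
      funext fun u => (A.left_incl (c u)).symm
    rw [heq] at h2
    exact h1.trans h2 (A.isOpenEmbedding_left_comp hd he).continuous.continuousAt
      (isOpenEmbedding_comp_of_closed_cover A.isClosedEmbedding_left.isEmbedding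
        A.isClosed_range_handle A.cover_handle hco
        fun u => A.notMem_range_handle hd (H.isInteriorPt_incl (isInteriorPt_of_mem_charts hc u)))
      (A.swap.isOpenEmbedding_left_comp hd.symm he') (congrArg A.left hs)
      (by rw [← h]; exact (congrArg A.left hs).symm)

/-- The surface with both handles attached. -/
def surface (hd : Disjoint H.attachingRegion H'.attachingRegion)
    [CompactSpace Z] [T2Space Z] : OrientedSurface.{u} where
  carrier := Z
  locally_half_plane := by
    intro z
    rcases A.exists_eq_left_or_right hd z with ⟨x, rfl, hx⟩ | ⟨x, rfl, hx⟩
    · exact surfacePt_of_closed_cover A.isClosedEmbedding_left.isEmbedding A.isClosed_range_handle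
        A.cover_handle hx (M.locally_half_plane x)
    · exact surfacePt_of_closed_cover A.isClosedEmbedding_right.isEmbedding
        A.swap.isClosed_range_handle A.swap.cover_handle hx (M'.locally_half_plane x)
  charts := (A.left ∘ ·) '' M.charts ∪ (A.right ∘ ·) '' M'.charts
  charts_open := by
    rintro _ (⟨e, he, rfl⟩ | ⟨e, he, rfl⟩)
    · exact A.isOpenEmbedding_left_comp hd he
    · exact A.swap.isOpenEmbedding_left_comp hd.symm he
  charts_cover := by
    intro z hz
    rcases A.exists_eq_left_or_right hd z with ⟨x, rfl, hx⟩ | ⟨x, rfl, hx⟩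
    · obtain ⟨e, he, w, rfl⟩ := M.charts_cover x ((A.isInteriorPt_left_iff hx).1 hz)
      exact ⟨_, .inl ⟨e, he, rfl⟩, w, rfl⟩
    · obtain ⟨e, he, w, rfl⟩ := M'.charts_cover x ((A.swap.isInteriorPt_left_iff hx).1 hz)
      exact ⟨_, .inr ⟨e, he, rfl⟩, w, rfl⟩
  charts_oriented := by
    rintro e (he | he) e' he' z w h
    · exact A.sameOrientationAt hd he he' h
    · exact A.swap.sameOrientationAt hd.symm he he'.symm h

/-- The amalgam as the result of attaching the second handle to the first piece. -/
def handleLeft {Z : OrientedSurface.{u}} (A : Amalgam H H' Z)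
    (hd : Disjoint H.attachingRegion H'.attachingRegion)
    (hZ : ∀ e ∈ M.charts, A.left ∘ e ∈ Z.charts) : OneHandle M Z where
  incl := A.left
  continuous_incl := A.isClosedEmbedding_left.continuous
  injective_incl := A.isClosedEmbedding_left.injective
  oriented_incl e he e' he' z w h := Z.charts_oriented _ (hZ e he) e' he' z w h
  handle := A.right ∘ H'.handle
  continuous_handle := A.isClosedEmbedding_right.continuous.comp H'.continuous_handle
  injective_handle := A.isClosedEmbedding_right.injective.comp H'.injective_handle
  cover := A.cover_handle
  attach_only x s t h := by
    obtain ⟨x', rfl, h'⟩ := (A.left_eq_right_iff _ _).1 h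
    exact H'.attach_only x' s t h'.symm
  attach_zero t := by
    obtain ⟨x, hx, h⟩ := H'.attach_zero t
    exact ⟨H.incl x, incl_mem_boundary hd ⟨_, h.symm⟩, by simp [A.left_incl, h]⟩
  attach_one t := by
    obtain ⟨x, hx, h⟩ := H'.attach_one t
    exact ⟨H.incl x, incl_mem_boundary hd ⟨_, h.symm⟩, by simp [A.left_incl, h]⟩
  side_zero s h := H'.side_zero s
    ((A.swap.isInteriorPt_left_iff (A.swap.handle_notMem_range_handle hd.symm _)).1 h)
  side_one s h := H'.side_one s
    ((A.swap.isInteriorPt_left_iff (A.swap.handle_notMem_range_handle hd.symm _)).1 h)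

end Amalgam

/-- Two one-handles with disjoint attaching regions can be attached simultaneously. -/
theorem exists_amalgam {S M M' : OrientedSurface.{u}} (H : OneHandle S M) (H' : OneHandle S M')
    (hd : Disjoint H.attachingRegion H'.attachingRegion) :
    ∃ (Z : OrientedSurface.{u}) (A : Amalgam H H' Z),
      Z.charts = (A.left ∘ ·) '' M.charts ∪ (A.right ∘ ·) '' M'.charts := by
  have hc := H.isClosedEmbedding_incl
  have hc' := H'.isClosedEmbedding_incl
  have := Gluing.t2Space hc hc'
  set A : Amalgam H H' (Gluing H.incl H'.incl) :=
    { left := Gluing.left _ _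
      right := Gluing.right _ _
      isClosedEmbedding_left := Gluing.isClosedEmbedding_left H.continuous_incl hc'
      isClosedEmbedding_right := Gluing.isClosedEmbedding_right hc hc'
      cover := Gluing.range_left_union_range_right
      left_eq_right_iff := fun _ _ => Gluing.left_eq_right_iff H'.injective_incl }
  exact ⟨A.surface hd, A, rfl⟩

end OrientedSurface

/-! ### Isotopy relative to the boundary, conjugation and reparametrised handles -/

namespace OrientedSurface

/-- The map `(t, x) ↦ (t, F t x)` is a continuous bijection of a compact Hausdorff space, hence a
homeomorphism. -/
theorem continuous_symm_family {T X : Type*} [TopologicalSpace T] [CompactSpace T] [T2Space T]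
    [TopologicalSpace X] [CompactSpace X] [T2Space X] {F : T → X ≃ₜ X}
    (hF : Continuous fun p : T × X => F p.1 p.2) : Continuous fun p : T × X => (F p.1).symm p.2 := by
  let E : T × X ≃ T × X :=
    { toFun := fun p => (p.1, F p.1 p.2)
      invFun := fun p => (p.1, (F p.1).symm p.2)
      left_inv := fun p => by simp
      right_inv := fun p => by simp }
  have hE : Continuous E := continuous_fst.prodMk hF
  exact continuous_snd.comp (Continuous.homeoOfEquivCompactToT2 hE).symm.continuous

theorem orientationPreserving_of_isIsotopicToId {S : OrientedSurface.{u}} {N : Set S} {k : S ≃ₜ S}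
    (h : IsIsotopicToId N k) : OrientationPreserving S S k := by
  obtain ⟨F, hF, h0, rfl, -⟩ := h
  exact orientationPreserving_of_isotopy F hF (a := 0) (h0 ▸ orientationPreserving_refl S)

/-- Isotopy relative to the boundary, for arbitrary homeomorphisms. -/
def IsotopicRel (S : OrientedSurface.{u}) (f g : S ≃ₜ S) : Prop :=
  ContinuousMap.HomotopicWith (f : C(S, S)) (g : C(S, S))
    fun h => IsHomeomorph h ∧ ∀ x ∈ S.boundary, h x = x

theorem IsotopicRel.exists_family {S : OrientedSurface.{u}} {f g : S ≃ₜ S} (h : IsotopicRel S f g) :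
    ∃ F : unitInterval → S ≃ₜ S, (Continuous fun p : unitInterval × S => F p.1 p.2) ∧
      F 0 = f ∧ F 1 = g ∧ ∀ t, ∀ x ∈ S.boundary, F t x = x := by
  obtain ⟨K⟩ := h
  have hK : ∀ t, IsHomeomorph fun x => K (t, x) := fun t => (K.prop' t).1
  refine ⟨fun t => (hK t).homeomorph, K.continuous, ?_, ?_, fun t => (K.prop' t).2⟩
  · ext x
    exact K.apply_zero x
  · ext x
    exact K.apply_one x

theorem isotopicRel_of_family {S : OrientedSurface.{u}} (F : unitInterval → S ≃ₜ S)
    (hF : Continuous fun p : unitInterval × S => F p.1 p.2)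
    (hb : ∀ t, ∀ x ∈ S.boundary, F t x = x) : IsotopicRel S (F 0) (F 1) :=
  ⟨{  toFun := fun p => F p.1 p.2
      continuous_toFun := hF
      map_zero_left := fun _ => rfl
      map_one_left := fun _ => rfl
      prop' := fun t => ⟨(F t).isHomeomorph, hb t⟩ }⟩

theorem IsotopicRel.orientationPreserving {S : OrientedSurface.{u}} {f g : S ≃ₜ S}
    (h : IsotopicRel S f g) (hf : OrientationPreserving S S f) : OrientationPreserving S S g := by
  obtain ⟨F, hF, rfl, rfl, -⟩ := h.exists_family
  exact orientationPreserving_of_isotopy F hF hf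

/-- Conjugation by a homeomorphism isotopic to the identity, not necessarily relative to the
boundary, does not change the isotopy class relative to the boundary. -/
theorem isotopicRel_conj {S : OrientedSurface.{u}} {N : Set S} {k φ : S ≃ₜ S}
    (hk : IsIsotopicToId N k) (hφ : ∀ x ∈ S.boundary, φ x = x) :
    IsotopicRel S φ ((k.symm.trans φ).trans k) := by
  obtain ⟨F, hF, h0, rfl, -⟩ := hk
  -- Each `F t` may move the boundary but preserves it as a set. As `φ` fixes it pointwise, so does
  -- the conjugate of `φ` by `F t`.
  have := isotopicRel_of_family (fun t => ((F t).symm.trans φ).trans (F t))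
    (hF.comp (continuous_fst.prodMk (φ.continuous.comp (continuous_symm_family hF))))
    fun t x hx => by
      simp only [Homeomorph.trans_apply]
      rw [hφ _ (((F t).symm.mem_boundary_iff x).2 hx), Homeomorph.apply_symm_apply]
  simp only [h0] at this
  exact this

theorem IsotopicRel.ext {S M : OrientedSurface.{u}} (H : OneHandle S M) {f g : S ≃ₜ S}
    (h : IsotopicRel S f g) (hf : ∀ x ∈ S.boundary, f x = x) (hg : ∀ x ∈ S.boundary, g x = x)
    {T : M ≃ₜ M} (hT : ∀ x ∈ M.boundary, T x = x) :
    IsotopicRel M (T.trans (H.ext f hf)) (T.trans (H.ext g hg)) := by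
  obtain ⟨F, hF, rfl, rfl, hb⟩ := h.exists_family
  refine isotopicRel_of_family (fun t => T.trans (H.ext (F t) (hb t))) ?_ fun t x hx => ?_
  · exact (H.continuous_extFun hF hb).comp (f := fun p : unitInterval × M => (p.1, T p.2))
      (by fun_prop)
  · rw [Homeomorph.trans_apply, hT x hx, H.ext_apply_of_mem_boundary _ _ x hx]

/-- The image of a proper arc under a homeomorphism. -/
def ProperArc.map {S : OrientedSurface.{u}} (α : S.ProperArc) (k : S ≃ₜ S) : S.ProperArc where
  toFun := k ∘ α.toFun
  continuous_toFun := k.continuous.comp α.continuous_toFun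
  injective_toFun := k.injective.comp α.injective_toFun
  map_zero := (k.mem_boundary_iff _).2 α.map_zero
  map_one := (k.mem_boundary_iff _).2 α.map_one
  map_interior t h h' := fun hb => α.map_interior t h h' ((k.mem_boundary_iff _).1 hb)

/-- The same handle, with the inclusion of the old surface precomposed with `k⁻¹`. -/
def OneHandle.reparam {S M : OrientedSurface.{u}} (H : OneHandle S M) (k : S ≃ₜ S)
    (hk : OrientationPreserving S S k) : OneHandle S M where
  incl := H.incl ∘ k.symm
  continuous_incl := H.continuous_incl.comp k.symm.continuous
  injective_incl := H.injective_incl.comp k.symm.injective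
  oriented_incl := H.oriented_incl.comp hk.symm H.continuous_incl
    (fun e he => H.isOpenEmbedding_incl_comp (S.charts_open e he) (isInteriorPt_of_mem_charts he))
    k.symm.continuous fun x hx => (k.symm.isInteriorPt_iff x).2 hx
  handle := H.handle
  continuous_handle := H.continuous_handle
  injective_handle := H.injective_handle
  cover := by rw [k.symm.surjective.range_comp, H.cover]
  attach_only x := H.attach_only (k.symm x)
  attach_zero t := by
    obtain ⟨x, hx, h⟩ := H.attach_zero t
    exact ⟨k x, (k.mem_boundary_iff x).2 hx, by simp [h]⟩
  attach_one t := by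
    obtain ⟨x, hx, h⟩ := H.attach_one t
    exact ⟨k x, (k.mem_boundary_iff x).2 hx, by simp [h]⟩
  side_zero := H.side_zero
  side_one := H.side_one

end OrientedSurface

/-! ### Normalising the data of a stabilisation -/

namespace AbstractOpenBook

/-- `B'` is the positive stabilisation of `B` by the handle `H`, along the arc `α`, where `φ`
represents the monodromy of `B`, and `ψ` that of `B'`. -/
structure StabilisationData (B B' : AbstractOpenBook.{u}) (φ : B.page.RelHomeo)
    (H : OneHandle B.page B'.page) where
  arc : B.page.ProperArc
  core_zero : H.core 0 = H.incl (arc.toFun 0)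
  core_one : H.core 1 = H.incl (arc.toFun 1)
  annulus : Annulus B'.page
  twist : B'.page ≃ₜ B'.page
  core_annulus : annulus.core = range (H.incl ∘ arc.toFun) ∪ range H.core
  isPositiveTwist : annulus.IsPositiveTwist twist
  ψ : B'.page.RelHomeo
  ψ_eq : ψ.1 = twist.trans (H.ext φ.1 φ.2.2)
  class_ψ : B'.page.mappingClass ψ = B'.monodromy

/-- The inclusion of the old page may be changed by an isotopy, and the representative of the old
monodromy is arbitrary. -/
theorem IsStabilisation.exists_data {B B' : AbstractOpenBook.{u}} (h : B.IsStabilisation B') :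
    ∃ H : OneHandle B.page B'.page, ∀ (k : B.page ≃ₜ B.page) (φ : B.page.RelHomeo),
      IsIsotopicToId univ k → B.page.mappingClass φ = B.monodromy →
      ∃ H' : OneHandle B.page B'.page, H'.attachingRegion = k.symm ⁻¹' H.attachingRegion ∧
        Nonempty (StabilisationData B B' φ H') := by
  obtain ⟨α, H, h0, h1, A, T, φα, φ', ψ, hA, hT, hφ', hφα, hφα', hψ, hψc⟩ := h
  refine ⟨H, fun k φ hk hφ => ?_⟩
  set H' := H.reparam k (orientationPreserving_of_isIsotopicToId hk) with hH'
  have hiso : IsotopicRel B.page φ'.1 φ.1 := Quotient.exact (hφ'.trans hφ.symm)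
  have hconj := isotopicRel_conj hk φ'.2.2
  have hcb : ∀ x ∈ B.page.boundary, ((k.symm.trans φ'.1).trans k) x = x := by
    intro x hx
    simp only [Homeomorph.trans_apply]
    rw [φ'.2.2 _ ((k.symm.mem_boundary_iff x).2 hx), Homeomorph.apply_symm_apply]
  -- Extending `k φ' k⁻¹` over the handle reparametrised by `k⁻¹` gives the same homeomorphism as
  -- extending `φ'` over the original one. The curve, the annulus and the twist do not change
  -- either.
  have hψ' : ψ.1 = T.trans (H'.ext _ hcb) := by
    ext x
    rw [hψ, Homeomorph.trans_apply]
    refine H'.eq_ext hcb (fun y => ?_) hφα' (T x)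
    simp [hH', OneHandle.reparam, hφα]
  have hTb := hT.apply_of_mem_boundary
  -- Relative to the boundary `k φ' k⁻¹` is isotopic to `φ'`, and `φ'` to `φ`; the isotopy extends
  -- over the handle.
  have hiso' : IsotopicRel B'.page ψ.1 (T.trans (H'.ext φ.1 φ.2.2)) :=
    hψ' ▸ IsotopicRel.ext H' (hconj.symm.trans hiso) hcb φ.2.2 hTb
  refine ⟨H', rfl, ⟨{
    arc := α.map k
    core_zero := h0.trans (congrArg H.incl (k.symm_apply_apply _).symm)
    core_one := h1.trans (congrArg H.incl (k.symm_apply_apply _).symm)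
    annulus := A
    twist := T
    core_annulus := by
      rw [hA]
      simp only [hH', OneHandle.reparam, ProperArc.map, Function.comp_def,
        Homeomorph.symm_apply_apply]
      rfl
    isPositiveTwist := hT
    ψ := ⟨T.trans (H'.ext φ.1 φ.2.2), hiso'.orientationPreserving ψ.2.1, fun x hx => by
      rw [Homeomorph.trans_apply, hTb x hx, H'.ext_apply_of_mem_boundary _ _ x hx]⟩
    ψ_eq := rfl
    class_ψ := (Quotient.sound (s := B'.page.isotopySetoid) (a := ψ) hiso').symm.trans hψc }⟩⟩

/-- The extension is `ψ` composed with the inverse twist, and both preserve the orientation. This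
avoids an analysis along the feet of the handle. -/
theorem StabilisationData.orientationPreserving_ext {B B' : AbstractOpenBook.{u}}
    {φ : B.page.RelHomeo} {H : OneHandle B.page B'.page} (D : StabilisationData B B' φ H) :
    OrientationPreserving B'.page B'.page (H.ext φ.1 φ.2.2) := by
  have h := D.isPositiveTwist.orientationPreserving.symm.trans D.ψ.2.1
  rw [D.ψ_eq] at h
  convert h using 1
  ext x
  simp

end AbstractOpenBook

namespace OrientedSurface

/-- A proper arc of the old surface whose ends avoid the attaching region is a proper arc of the
new one. -/
def ProperArc.incl {S M : OrientedSurface.{u}} (α : S.ProperArc) (H : OneHandle S M)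
    (h0 : H.incl (α.toFun 0) ∈ M.boundary) (h1 : H.incl (α.toFun 1) ∈ M.boundary) : M.ProperArc where
  toFun := H.incl ∘ α.toFun
  continuous_toFun := H.continuous_incl.comp α.continuous_toFun
  injective_toFun := H.injective_incl.comp α.injective_toFun
  map_zero := h0
  map_one := h1
  map_interior t h h' := fun hb =>
    hb (H.isInteriorPt_incl (not_not.1 (α.map_interior t h h')))

theorem OneHandle.ext_trans {S M : OrientedSurface.{u}} (H : OneHandle S M) {f g : S ≃ₜ S}
    (hf : ∀ x ∈ S.boundary, f x = x) (hg : ∀ x ∈ S.boundary, g x = x)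
    (hfg : ∀ x ∈ S.boundary, f.trans g x = x) (y : M) :
    H.ext (f.trans g) hfg y = H.ext g hg (H.ext f hf y) :=
  (H.extFun_extFun hg hf y).symm

theorem OneHandle.ext_symm_incl {S M : OrientedSurface.{u}} (H : OneHandle S M) {f : S ≃ₜ S}
    (hf : ∀ x ∈ S.boundary, f x = x) (x : S) :
    (H.ext f hf).symm (H.incl x) = H.incl (f.symm x) := by
  rw [Homeomorph.symm_apply_eq, H.ext_incl, Homeomorph.apply_symm_apply]

theorem OneHandle.ext_symm_handle {S M : OrientedSurface.{u}} (H : OneHandle S M) {f : S ≃ₜ S}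
    (hf : ∀ x ∈ S.boundary, f x = x) (p : unitInterval × unitInterval) :
    (H.ext f hf).symm (H.handle p) = H.handle p := by
  rw [Homeomorph.symm_apply_eq, H.ext_handle]

/-- A homeomorphism of an amalgam that restricts to orientation preserving homeomorphisms of the
two pieces preserves the orientation. -/
theorem Amalgam.orientationPreserving {S M M' Z : OrientedSurface.{u}} {H : OneHandle S M}
    {H' : OneHandle S M'} (A : Amalgam H H' Z)
    (hZ : Z.charts = (A.left ∘ ·) '' M.charts ∪ (A.right ∘ ·) '' M'.charts) {F : Z ≃ₜ Z}
    {f : M ≃ₜ M} {f' : M' ≃ₜ M'} (hf : OrientationPreserving M M f)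
    (hf' : OrientationPreserving M' M' f') (hFf : ∀ x, F (A.left x) = A.left (f x))
    (hFf' : ∀ x, F (A.right x) = A.right (f' x)) : OrientationPreserving Z Z F := by
  intro e he e' he' z w h
  have he₀ := he
  rw [hZ] at he
  rcases he with ⟨c, hc, rfl⟩ | ⟨c, hc, rfl⟩
  · obtain ⟨d, hd, v, hv⟩ := M.charts_cover _
      ((f.isInteriorPt_iff _).2 (isInteriorPt_of_mem_charts hc z))
    have hd' : A.left ∘ d ∈ Z.charts := hZ ▸ .inl ⟨d, hd, rfl⟩
    have h1 := (hf c hc d hd z v hv.symm).comp_left A.left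
    have heq : A.left ∘ f ∘ c = F ∘ A.left ∘ c := funext fun u => (hFf _).symm
    rw [heq] at h1
    have hz : F (A.left (c z)) = A.left (d v) := by rw [hFf, hv]
    exact h1.trans (Z.charts_oriented _ hd' e' he' v w (hz.symm.trans h))
      (F.continuous.comp (Z.charts_open _ he₀).continuous).continuousAt (Z.charts_open _ hd')
      (Z.charts_open e' he') hz (hz.symm.trans h)
  · obtain ⟨d, hd, v, hv⟩ := M'.charts_cover _
      ((f'.isInteriorPt_iff _).2 (isInteriorPt_of_mem_charts hc z))
    have hd' : A.right ∘ d ∈ Z.charts := hZ ▸ .inr ⟨d, hd, rfl⟩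
    have h1 := (hf' c hc d hd z v hv.symm).comp_left A.right
    have heq : A.right ∘ f' ∘ c = F ∘ A.right ∘ c := funext fun u => (hFf' _).symm
    rw [heq] at h1
    have hz : F (A.right (c z)) = A.right (d v) := by rw [hFf', hv]
    exact h1.trans (Z.charts_oriented _ hd' e' he' v w (hz.symm.trans h))
      (F.continuous.comp (Z.charts_open _ he₀).continuous).continuousAt (Z.charts_open _ hd')
      (Z.charts_open e' he') hz (hz.symm.trans h)

end OrientedSurface

/-! ### The diamond property -/

namespace AbstractOpenBook

/-- Stabilisations by handles with disjoint attaching regions have a common stabilisation. -/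
theorem StabilisationData.exists_common {B B₁ B₂ : AbstractOpenBook.{u}} {φ : B.page.RelHomeo}
    {H₁ : OneHandle B.page B₁.page} {H₂ : OneHandle B.page B₂.page}
    (D₁ : StabilisationData B B₁ φ H₁) (D₂ : StabilisationData B B₂ φ H₂)
    (hd : Disjoint H₁.attachingRegion H₂.attachingRegion) :
    ∃ B₃ : AbstractOpenBook.{u}, B₁.IsStabilisation B₃ ∧ B₂.IsStabilisation B₃ := by
  obtain ⟨Z, A, hZ⟩ := exists_amalgam H₁ H₂ hd
  -- `J₁` attaches the handle of `H₂` to the first page, and `J₂` the handle of `H₁` to the second.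
  set J₁ : OneHandle B₁.page Z := A.handleLeft hd fun e he => hZ ▸ .inl ⟨e, he, rfl⟩ with hJ₁
  set J₂ : OneHandle B₂.page Z := A.swap.handleLeft hd.symm fun e he => hZ ▸ .inr ⟨e, he, rfl⟩
    with hJ₂
  have hJ : ∀ s, J₁.incl (H₁.incl s) = J₂.incl (H₂.incl s) := A.left_incl
  have hh₁ : ∀ p, J₁.handle p = J₂.incl (H₂.handle p) := fun _ => rfl
  have hh₂ : ∀ p, J₂.handle p = J₁.incl (H₁.handle p) := fun _ => rfl
  set φ₁ := H₁.ext φ.1 φ.2.2 with hφ₁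
  set φ₂ := H₂.ext φ.1 φ.2.2 with hφ₂
  have hφ₁b : ∀ x ∈ B₁.page.boundary, φ₁ x = x := H₁.ext_apply_of_mem_boundary _ _
  have hφ₂b : ∀ x ∈ B₂.page.boundary, φ₂ x = x := H₂.ext_apply_of_mem_boundary _ _
  have hT₁b := D₁.isPositiveTwist.apply_of_mem_boundary
  have hT₂b := D₂.isPositiveTwist.apply_of_mem_boundary
  set Φ : Z ≃ₜ Z := J₁.ext φ₁ hφ₁b with hΦ
  have hΦ₁ : ∀ x, Φ (J₁.incl x) = J₁.incl (φ₁ x) := J₁.ext_incl _ _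
  -- `Φ` is symmetric in the two pieces: it is also the extension of `φ₂` over `J₂`.
  have hΦ₂ : ∀ x, Φ (J₂.incl x) = J₂.incl (φ₂ x) := by
    intro x
    rcases H₂.exists_eq x with ⟨s, rfl⟩ | ⟨p, rfl⟩
    · rw [← hJ, hΦ₁, hφ₁, H₁.ext_incl, hJ, hφ₂, H₂.ext_incl]
    · rw [← hh₁, hΦ, J₁.ext_handle, hφ₂, H₂.ext_handle, hh₁]
  have hΦ' : ∀ y, Φ y = J₂.ext φ₂ hφ₂b y := J₂.eq_ext hφ₂b hΦ₂ fun p => by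
    rw [hh₂, hΦ₁, hφ₁, H₁.ext_handle]
  have hΦo : OrientationPreserving Z Z Φ :=
    A.orientationPreserving hZ D₁.orientationPreserving_ext D₂.orientationPreserving_ext hΦ₁ hΦ₂
  set T₁ : Z ≃ₜ Z := J₁.ext D₁.twist hT₁b with hT₁
  set T₂ : Z ≃ₜ Z := J₂.ext D₂.twist hT₂b with hT₂
  have htw₁ := J₁.isPositiveTwist_ext D₁.isPositiveTwist
  have htw₂ := J₂.isPositiveTwist_ext D₂.isPositiveTwist
  have hT₂o : OrientationPreserving Z Z T₂ := htw₂.orientationPreserving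
  -- As a composite of maps, `Ψ = Φ ∘ T₁ ∘ T₂`.
  set Ψ : Z.RelHomeo := ⟨T₂.trans (T₁.trans Φ),
    hT₂o.trans (OrientationPreserving.trans (f := T₁) htw₁.orientationPreserving hΦo),
    fun x hx => by
      rw [Homeomorph.trans_apply, Homeomorph.trans_apply, J₂.ext_apply_of_mem_boundary _ _ x hx,
        J₁.ext_apply_of_mem_boundary _ _ x hx, J₁.ext_apply_of_mem_boundary _ _ x hx]⟩ with hΨ
  have hψ₁ : ∀ y, J₁.ext D₁.ψ.1 D₁.ψ.2.2 y = Φ (T₁ y) := fun y => by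
    have := J₁.ext_trans hT₁b hφ₁b (by rw [hφ₁, ← D₁.ψ_eq]; exact D₁.ψ.2.2) y
    rw [← this]
    congr 2
    exact D₁.ψ_eq
  have hψ₂ : ∀ y, J₂.ext D₂.ψ.1 D₂.ψ.2.2 y = Φ (T₂ y) := fun y => by
    have := J₂.ext_trans hT₂b hφ₂b (by rw [hφ₂, ← D₂.ψ_eq]; exact D₂.ψ.2.2) y
    rw [hΦ', ← this]
    congr 2
    exact D₂.ψ_eq
  have ha₁ : ∀ t, (t = 0 ∨ t = 1) → H₂.incl (D₁.arc.toFun t) ∈ B₂.page.boundary := by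
    rintro t (rfl | rfl)
    · exact Amalgam.incl_mem_boundary hd.symm ⟨_, D₁.core_zero⟩
    · exact Amalgam.incl_mem_boundary hd.symm ⟨_, D₁.core_one⟩
  have ha₂ : ∀ t, (t = 0 ∨ t = 1) → H₁.incl (D₂.arc.toFun t) ∈ B₁.page.boundary := by
    rintro t (rfl | rfl)
    · exact Amalgam.incl_mem_boundary hd ⟨_, D₂.core_zero⟩
    · exact Amalgam.incl_mem_boundary hd ⟨_, D₂.core_one⟩
  have hc₁ : ∀ s, J₁.core s = J₂.incl (H₂.core s) := fun _ => rfl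
  have hc₂ : ∀ s, J₂.core s = J₁.incl (H₁.core s) := fun _ => rfl
  refine ⟨⟨Z, ⟨_, J₁.side_zero 0⟩, Z.mappingClass Ψ⟩, ?_, ?_⟩
  -- Here `Ψ = (Φ ∘ T₁) ∘ T₂`, where `Φ ∘ T₁` extends the monodromy of `B₁`.
  · refine ⟨D₂.arc.incl H₁ (ha₂ 0 (.inl rfl)) (ha₂ 1 (.inr rfl)), J₁, ?_, ?_, J₂.mapAnnulus D₂.annulus,
      T₂, J₁.ext D₁.ψ.1 D₁.ψ.2.2, D₁.ψ, Ψ, ?_, htw₂, D₁.class_ψ, J₁.ext_incl _ _, J₁.ext_handle _ _,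
      fun x => (hψ₁ _).symm, rfl⟩
    · rw [hc₁, D₂.core_zero, ← hJ]
      rfl
    · rw [hc₁, D₂.core_one, ← hJ]
      rfl
    · rw [J₂.core_mapAnnulus, D₂.core_annulus, image_union, ← range_comp, ← range_comp]
      simp only [ProperArc.incl, Function.comp_def, hJ, ← hc₁]
  -- Here `Ψ = (Φ ∘ T₂) ∘ (T₂⁻¹ ∘ T₁ ∘ T₂)`, so arc and annulus are moved by `T₂⁻¹`. The ends of the
  -- arc and the core of `J₂` stay put, because the second twist fixes the boundary of its page and
  -- extends by the identity over the handle.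
  · have hk : OrientationPreserving Z Z T₂.symm := hT₂o.symm
    have hfix : ∀ t, (t = 0 ∨ t = 1) →
        D₂.twist.symm (H₂.incl (D₁.arc.toFun t)) = H₂.incl (D₁.arc.toFun t) := fun t ht =>
      OneHandle.symm_apply_of_mem_boundary hT₂b _ (ha₁ t ht)
    refine ⟨(D₁.arc.incl H₂ (ha₁ 0 (.inl rfl)) (ha₁ 1 (.inr rfl))).map D₂.twist.symm, J₂, ?_, ?_,
      (J₁.mapAnnulus D₁.annulus).mapHomeo T₂.symm hk, _, J₂.ext D₂.ψ.1 D₂.ψ.2.2, D₂.ψ, Ψ, ?_,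
      htw₁.mapHomeo T₂.symm hk, D₂.class_ψ, J₂.ext_incl _ _, J₂.ext_handle _ _, fun x => ?_, rfl⟩
    · rw [hc₂, D₁.core_zero, hJ]
      exact congrArg J₂.incl (hfix 0 (.inl rfl)).symm
    · rw [hc₂, D₁.core_one, hJ]
      exact congrArg J₂.incl (hfix 1 (.inr rfl)).symm
    · rw [Annulus.core_mapHomeo, J₁.core_mapAnnulus, D₁.core_annulus, image_union, image_union,
        ← range_comp, ← range_comp, ← range_comp, ← range_comp]
      simp only [ProperArc.incl, ProperArc.map, Function.comp_def, hJ, ← hc₂, hT₂, J₂.ext_symm_incl]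
      simp only [OneHandle.core, J₂.ext_symm_handle]
      rfl
    · rw [hψ₂]
      simp [hΨ, hT₁]

theorem IsStabilisation.exists_common {B B₁ B₂ : AbstractOpenBook.{u}} (h₁ : B.IsStabilisation B₁)
    (h₂ : B.IsStabilisation B₂) :
    ∃ B₃ : AbstractOpenBook.{u}, B₁.IsStabilisation B₃ ∧ B₂.IsStabilisation B₃ := by
  obtain ⟨φ, hφ⟩ := Quotient.exists_rep B.monodromy
  obtain ⟨H₁, hH₁⟩ := h₁.exists_data
  obtain ⟨H₂, hH₂⟩ := h₂.exists_data
  -- The target points `Q₂` are chosen off `Q₁`; disjoint finite sets have disjoint neighbourhoods,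
  -- into which the two attaching regions are shrunk.
  obtain ⟨Q₁, hQ₁, -, hs₁⟩ := H₁.exists_shrink_attachingRegion ∅ finite_empty
  obtain ⟨Q₂, hQ₂, hQ, hs₂⟩ := H₂.exists_shrink_attachingRegion Q₁ hQ₁
  obtain ⟨O₁, O₂, hO₁, hO₂, hQO₁, hQO₂, hO⟩ :=
    SeparatedNhds.of_isCompact_isCompact hQ₁.isCompact hQ₂.isCompact hQ
  obtain ⟨k₁, hk₁, hkO₁⟩ := hs₁ O₁ hO₁ hQO₁
  obtain ⟨k₂, hk₂, hkO₂⟩ := hs₂ O₂ hO₂ hQO₂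
  obtain ⟨H₁', ha₁, ⟨D₁⟩⟩ := hH₁ k₁ φ hk₁ hφ
  obtain ⟨H₂', ha₂, ⟨D₂⟩⟩ := hH₂ k₂ φ hk₂ hφ
  refine D₁.exists_common D₂ (hO.mono ?_ ?_)
  · rw [ha₁]
    exact fun x hx => k₁.apply_symm_apply x ▸ hkO₁ _ hx
  · rw [ha₂]
    exact fun x hx => k₂.apply_symm_apply x ▸ hkO₂ _ hx

end AbstractOpenBook

theorem theorem1 (B₁ Bₙ : AbstractOpenBook.{u})
    (h : Relation.EqvGen AbstractOpenBook.IsStabilisation B₁ Bₙ) :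
    ∃ B : AbstractOpenBook.{u},
      Relation.ReflTransGen AbstractOpenBook.IsStabilisation B₁ B ∧
      Relation.ReflTransGen AbstractOpenBook.IsStabilisation Bₙ B := by
  -- Church–Rosser: the one-step diamond makes joinability transitive.
  have hequiv : Equivalence
      (Relation.Join (Relation.ReflTransGen AbstractOpenBook.IsStabilisation.{u})) :=
    Relation.equivalence_join_reflTransGen fun a b c hab hac => by
      obtain ⟨d, hb, hc⟩ := hab.exists_common hac
      exact ⟨d, .single hb, .single hc⟩
  exact hequiv.eqvGen_iff.1
    (h.mono fun a b hab => ⟨b, .single hab, .refl⟩)
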